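/- Let $1\le p<\infty$ and let $\mu:\mathbb R\to\mathbb R$ be a weight such that $\mu(t)\ge 1$ for all $t$, $\mu$ is even and nondecreasing on $(0,\infty)$, $\mu(t+s)\le\mu(t)\mu(s)$ for all $s,t\in\mathbb R$, and $\int_{-\infty}^{\infty}\frac{\ln\mu(t)}{1+t^2}\,dt<\infty$. Let $L_p(\mathbb R,\mu^p)$ be the space of (classes of) measurable functions $x:\mathbb R\to\mathbb C$ with $\|x\|^p=\int_{-\infty}^{\infty}|x(s)|^p\mu^p(s)\,ds<\infty$. For $f\in L_p(\mathbb R,\mu^p)$ and $r>0$ put $$\mathcal E_r(f)=\inf_g\|f-g\|,$$ the infimum being over all $g\in L_p(\mathbb R,\mu^p)$ that are restrictions to $\mathbb R$ of entire functions of exponential type at most $r$. For $k\in\mathbb N=\{1,2,\dots\}$ and $t\ge 0$ put $$\omega_k(t,f)=\sup_{0\le\tau\le t}\|(U(\tau)-I)^kf\|,\qquad (U(\tau)f)(s)=f(s+\tau).$$ Let $W_p^n(\mathbb R,\mu^p)$ be the set of those $f\in L_p(\mathbb R,\mu^p)$ for which $f,f',\dots,f^{(n-1)}$ are (after modification on a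 null set) absolutely continuous on every bounded interval and $f',\dots,f^{(n)}\in L_p(\mathbb R,\mu^p)$. Let $\omega:[0,\infty)\to[0,\infty)$ satisfy: 1. $\omega$ is continuous and nondecreasing; 2. $\omega(0)=0$, and $\omega(t)>0$ for $t>0$; 3. there is $c>0$ such that $\omega(2t)\le c\,\omega(t)$ for all $t\in[0,1]$; 4. $\int_0^1\frac{\omega(t)}{t}\,dt<\infty$. If, for $f\in L_p(\mathbb R,\mu^p)$, there exist $n\in\mathbb N$ and $m>0$ such that $$\mathcal E_r(f)\le\frac{m}{r^n}\,\omega\!\left(\frac1r\right),\qquad r\ge 1,$$ then $f\in W_p^n(\mathbb R,\mu^p)$, and for every $k\in\mathbb N$ there exists $m_k>0$ such that $$\omega_k(t,f^{(n)})\le m_k\left(t^k\int_t^1\frac{\omega(u)}{u^{k+1}}\,du+\int_0^t\frac{\omega(u)}{u}\,du\right),\qquad 0<t\le\tfrac12 .$$ -/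

import Mathlib

open MeasureTheory Set
open scoped ENNReal

noncomputable section

/-- The class of weights: `μ ≥ 1`, even, non-decreasing on `(0, ∞)`, submultiplicative, and
with finite logarithmic integral (the integrand `log μ(t) / (1 + t²)` is non-negative). -/
structure IsWeight (μ : ℝ → ℝ) : Prop where
  one_le : ∀ t, 1 ≤ μ t
  even : ∀ t, μ (-t) = μ t
  monotone : MonotoneOn μ (Ioi 0)
  submul : ∀ s t, μ (t + s) ≤ μ t * μ s
  log_integrable : Integrable (fun t : ℝ => Real.log (μ t) / (1 + t ^ 2))

/-- The measure `μ(s)^p ds` on the real line. -/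
def weightMeasure (p : ℝ) (μ : ℝ → ℝ) : Measure ℝ :=
  volume.withDensity (fun s => ENNReal.ofReal (μ s ^ p))

/-- `x ∈ L_p(ℝ, μ^p)`, for a complex-valued function `x`. -/
def MemWeightedLp (p : ℝ) (μ : ℝ → ℝ) (x : ℝ → ℂ) : Prop :=
  MemLp x (ENNReal.ofReal p) (weightMeasure p μ)

/-- The norm `(∫ |x(s)|^p μ(s)^p ds)^(1/p)` of `L_p(ℝ, μ^p)`, as an extended real. -/
def weightedNorm (p : ℝ) (μ : ℝ → ℝ) (x : ℝ → ℂ) : ℝ≥0∞ :=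
  eLpNorm x (ENNReal.ofReal p) (weightMeasure p μ)

/-- The differentiation operator `A` in `L_p(ℝ, μ^p)`: `x ∈ D(A)` and `A x = y`. The class of `x`
has an absolutely continuous representative whose derivative is `y` almost everywhere, and both
`x` and `y` lie in `L_p(ℝ, μ^p)`. -/
def IsDerivative (p : ℝ) (μ : ℝ → ℝ) (x y : ℝ → ℂ) : Prop :=
  MemWeightedLp p μ x ∧ MemWeightedLp p μ y ∧
    ∃ z : ℝ → ℂ, x =ᵐ[volume] z ∧
      (∀ a b : ℝ, AbsolutelyContinuousOnInterval z a b) ∧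
      ∀ᵐ t ∂(volume : Measure ℝ), HasDerivAt z (y t) t

/-- `f ∈ D(A^n)` and `A^n f = g`, that is, `g` is (a representative of) `f^{(n)}`, with all the
derivatives `f, f', …, f^{(n)}` in `L_p(ℝ, μ^p)`. -/
def IsNthDerivative (p : ℝ) (μ : ℝ → ℝ) : ℕ → (ℝ → ℂ) → (ℝ → ℂ) → Prop
  | 0, f, g => MemWeightedLp p μ f ∧ f =ᵐ[volume] g
  | n + 1, f, g => ∃ h : ℝ → ℂ, IsNthDerivative p μ n f h ∧ IsDerivative p μ h g

/-- The weighted Sobolev space `W_p^n(ℝ, μ^p) = D(A^n)`. -/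
def MemWeightedSobolev (p : ℝ) (μ : ℝ → ℝ) (n : ℕ) (f : ℝ → ℂ) : Prop :=
  ∃ g : ℝ → ℂ, IsNthDerivative p μ n f g

/-- `F` is an entire function of exponential type at most `σ`. -/
def IsEntireOfExpType (σ : ℝ) (F : ℂ → ℂ) : Prop :=
  Differentiable ℂ F ∧
    ∀ ε : ℝ, 0 < ε → ∃ C : ℝ, ∀ z : ℂ, ‖F z‖ ≤ C * Real.exp ((σ + ε) * ‖z‖)

/-- The best approximation of `f`, in the norm of `L_p(ℝ, μ^p)`, by entire functions of exponential
type at most `r` whose restrictions to the real line lie in `L_p(ℝ, μ^p)`. -/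
def bestApprox (p : ℝ) (μ : ℝ → ℝ) (r : ℝ) (f : ℝ → ℂ) : ℝ≥0∞ :=
  ⨅ (F : ℂ → ℂ) (_ : IsEntireOfExpType r F ∧ MemWeightedLp p μ (fun s : ℝ => F (s : ℂ))),
    weightedNorm p μ (fun s : ℝ => f s - F (s : ℂ))

/-- The `k`-th modulus of continuity `sup_{0 ≤ τ ≤ t} ‖(U(τ) - I)^k x‖`, where
`(U(τ) x)(s) = x(s + τ)`; `fwdDiff τ` is `U(τ) - I`. -/
def modulus (p : ℝ) (μ : ℝ → ℝ) (k : ℕ) (t : ℝ) (x : ℝ → ℂ) : ℝ≥0∞ :=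
  ⨆ τ ∈ Icc (0 : ℝ) t, weightedNorm p μ ((fwdDiff τ)^[k] x)

end

/-!
The proof is the classical inverse ("Bernstein") argument of approximation theory: `f` is written
as a telescoping series of differences of near-best approximations `g j` of type `2 ^ j`
(`exists_approximating_sequence`), and Bernstein's inequality is applied to every term. The
differentiated series converges by the Dini condition on `ω`, and since the differentiation
operator is closed (`isDerivative_of_tendsto`) its sum is the derivative of `f`. For the modulus of
continuity the series is split at the index `M` with `2 ^ (-M) ≈ t`: the low-frequency terms are
estimated by Bernstein's inequality for differences (`weightedNorm_fwdDiff_iterate_le_sum`), the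
remaining ones by the boundedness of translations, and the two dyadic sums are compared with the
two integrals (`sum_two_pow_mul_dyadic_le`, `tsum_dyadic_tail_le`).

The essential point is Bernstein's inequality `‖F'‖ ≤ K r ‖F‖` for entire `F` of type `r ≥ 1` in
the weighted space (`exists_weightedNorm_deriv_le`), with `K` independent of `r`. The finite
logarithmic integral of the weight yields an entire function `H` of exponential type with `H 0 = 1`
and `|H t| μ t ≤ C` on the real line (`IsWeight.exists_multiplier`), an infinite product of cosines.
Since the translation by `t` has norm at most `μ t`, the vector-valued entire function
`z ↦ H z • F (· + z)` is bounded by `C ‖F‖` on the real line. By the Phragmén–Lindelöf principle it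
is `O(‖F‖)` on the circle `|z| = 1 / r`, and Cauchy's estimate gives the bound for `F'`. As
`F (· + z)` is not known to lie in the weighted space for complex `z`, this is carried out in `L_p`
of a window `[-T, T]`, with bounds independent of `T`.
-/

open Filter Topology

/-! ### The weight and its measure -/

namespace IsWeight

variable {μ : ℝ → ℝ}

theorem pos (hμ : IsWeight μ) (t : ℝ) : 0 < μ t := zero_lt_one.trans_le (hμ.one_le t)

theorem abs_eq (hμ : IsWeight μ) (t : ℝ) : μ |t| = μ t := by
  rcases abs_cases t with ⟨h, _⟩ | ⟨h, _⟩ <;> simp [h, hμ.even]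

theorem measurable (hμ : IsWeight μ) : Measurable μ := by
  have hm : Measurable (Function.extend (Subtype.val : Ioi (0 : ℝ) → ℝ) (fun x => μ x)
      (fun _ => μ 0)) := by
    refine (MeasurableEmbedding.subtype_coe measurableSet_Ioi).measurable_extend ?_
      measurable_const
    exact Monotone.measurable fun a b hab => hμ.monotone a.2 b.2 hab
  have : μ = (Function.extend (Subtype.val : Ioi (0 : ℝ) → ℝ) (fun x => μ x)
      (fun _ => μ 0)) ∘ fun t => |t| := by
    funext t
    by_cases ht : t = 0
    · subst ht
      rw [Function.comp_apply, Function.extend_apply']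
      rintro ⟨a, ha⟩
      have := a.2
      simp_all
    · have h := Subtype.val_injective.extend_apply (fun x : Ioi (0 : ℝ) => μ x) (fun _ => μ 0)
        ⟨|t|, abs_pos.2 ht⟩
      simp only [Function.comp_apply]
      rw [h, hμ.abs_eq]
  rw [this]
  exact hm.comp (by fun_prop)

/-- A weight is bounded on every symmetric interval; the value at `0` is not controlled by the
monotonicity on `(0, ∞)` and enters separately. -/
theorem le_max (hμ : IsWeight μ) {t T : ℝ} (h : |t| ≤ T) : μ t ≤ max (μ 0) (μ T) := by
  by_cases ht : t = 0
  · subst ht; exact le_max_left _ _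
  · rw [← hμ.abs_eq]
    have h0 : 0 < |t| := abs_pos.2 ht
    exact (hμ.monotone h0 (h0.trans_le h) h).trans (le_max_right _ _)

theorem absolutelyContinuous_volume (hμ : IsWeight μ) (p : ℝ) :
    (volume : Measure ℝ) ≪ weightMeasure p μ := by
  refine withDensity_absolutelyContinuous' ?_ ?_
  · exact (hμ.measurable.pow_const p).ennreal_ofReal.aemeasurable
  · filter_upwards with t
    simpa using Real.rpow_pos_of_pos (hμ.pos t) p

theorem absolutelyContinuous_weightMeasure (p : ℝ) (μ : ℝ → ℝ) :
    weightMeasure p μ ≪ (volume : Measure ℝ) := withDensity_absolutelyContinuous _ _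

theorem ae_iff (hμ : IsWeight μ) (p : ℝ) {q : ℝ → Prop} :
    (∀ᵐ t ∂weightMeasure p μ, q t) ↔ ∀ᵐ t ∂(volume : Measure ℝ), q t :=
  ⟨fun h => hμ.absolutelyContinuous_volume p h,
    fun h => absolutelyContinuous_weightMeasure p μ h⟩

theorem volume_le (hμ : IsWeight μ) {p : ℝ} (hp : 0 ≤ p) :
    (volume : Measure ℝ) ≤ weightMeasure p μ := by
  conv_lhs => rw [← withDensity_one (μ := (volume : Measure ℝ))]
  refine withDensity_mono (ae_of_all _ fun t => ?_)
  simpa using Real.one_le_rpow (hμ.one_le t) hp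

theorem weightMeasure_Icc_lt_top (hμ : IsWeight μ) {p : ℝ} (hp : 0 ≤ p) (T : ℝ) :
    weightMeasure p μ (Icc (-T) T) < ∞ := by
  rw [weightMeasure, withDensity_apply _ measurableSet_Icc]
  calc ∫⁻ t in Icc (-T) T, ENNReal.ofReal (μ t ^ p)
      ≤ ∫⁻ _ in Icc (-T) T, ENNReal.ofReal (max (μ 0) (μ T) ^ p) := by
        refine setLIntegral_mono' measurableSet_Icc fun t ht => ?_
        exact ENNReal.ofReal_le_ofReal
          (Real.rpow_le_rpow (hμ.pos t).le (hμ.le_max (abs_le.2 ht)) hp)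
    _ < ∞ := by
        rw [setLIntegral_const]
        exact ENNReal.mul_lt_top ENNReal.ofReal_lt_top (by simp)

/-- Submultiplicativity of the weight, expressed for the translated measure. -/
theorem map_add_right_le (hμ : IsWeight μ) {p : ℝ} (hp : 0 ≤ p) (τ : ℝ) :
    (weightMeasure p μ).map (fun s => s + τ) ≤ ENNReal.ofReal (μ τ ^ p) • weightMeasure p μ := by
  have hm : Measurable fun t : ℝ => ENNReal.ofReal (μ t ^ p) :=
    (hμ.measurable.pow_const p).ennreal_ofReal
  refine Measure.le_iff.2 fun s hs => ?_
  have he : MeasurableEmbedding fun t : ℝ => t + τ := measurableEmbedding_addRight τ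
  rw [Measure.map_apply he.measurable hs, Measure.smul_apply, weightMeasure,
    withDensity_apply _ (he.measurable hs), withDensity_apply _ hs, smul_eq_mul,
    ← lintegral_const_mul _ hm]
  have h1 := (measurePreserving_add_right (volume : Measure ℝ) τ).setLIntegral_comp_preimage hs
    (f := fun t => ENNReal.ofReal (μ (t - τ) ^ p)) (hm.comp (measurable_id.sub_const τ))
  simp only [add_sub_cancel_right] at h1
  rw [h1]
  refine lintegral_mono fun t => ?_
  rw [← ENNReal.ofReal_mul (Real.rpow_nonneg (hμ.pos _).le _),
    ← Real.mul_rpow (hμ.pos _).le (hμ.pos _).le]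
  refine ENNReal.ofReal_le_ofReal (Real.rpow_le_rpow (hμ.pos _).le ?_ hp)
  have := hμ.submul (-τ) t
  rwa [hμ.even, mul_comm, ← sub_eq_add_neg] at this

end IsWeight

section Translation

variable {p : ℝ} {μ : ℝ → ℝ} {x y : ℝ → ℂ}

theorem weightedNorm_congr (hμ : IsWeight μ) (h : x =ᵐ[volume] y) :
    weightedNorm p μ x = weightedNorm p μ y :=
  eLpNorm_congr_ae ((hμ.ae_iff p).2 h)

theorem one_le_ofReal_exponent (hp : 1 ≤ p) : 1 ≤ ENNReal.ofReal p := by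
  simpa using ENNReal.ofReal_le_ofReal hp

theorem aestronglyMeasurable_comp_add_right (hμ : IsWeight μ)
    (hx : AEStronglyMeasurable x (weightMeasure p μ)) (τ : ℝ) :
    AEStronglyMeasurable (fun s => x (s + τ)) (weightMeasure p μ) := by
  have h := hx.mono_ac (hμ.absolutelyContinuous_volume p)
  exact (h.comp_measurePreserving (measurePreserving_add_right volume τ)).mono_ac
    (IsWeight.absolutelyContinuous_weightMeasure p μ)

/-- The translation `U(τ)` has norm at most `μ τ` in the weighted space. -/
theorem weightedNorm_comp_add_right_le (hp : 1 ≤ p) (hμ : IsWeight μ) (τ : ℝ) :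
    weightedNorm p μ (fun s => x (s + τ)) ≤ ENNReal.ofReal (μ τ) * weightedNorm p μ x := by
  have hp0 : 0 ≤ p := by linarith
  have he : MeasurableEmbedding fun t : ℝ => t + τ := measurableEmbedding_addRight τ
  have h1 : weightedNorm p μ (fun s => x (s + τ)) =
      eLpNorm x (ENNReal.ofReal p) ((weightMeasure p μ).map fun s => s + τ) :=
    (he.eLpNorm_map_measure).symm
  rw [h1]
  refine (eLpNorm_mono_measure x (hμ.map_add_right_le hp0 τ)).trans ?_
  rw [eLpNorm_smul_measure_of_ne_top (by simp), smul_eq_mul, weightedNorm,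
    ENNReal.ofReal_rpow_of_nonneg (Real.rpow_nonneg (hμ.pos _).le _) (by positivity),
    ENNReal.toReal_div, ENNReal.toReal_ofReal hp0, ENNReal.toReal_one,
    ← Real.rpow_mul (hμ.pos _).le, mul_one_div_cancel (by linarith), Real.rpow_one]

theorem MemWeightedLp.comp_add_right (hp : 1 ≤ p) (hμ : IsWeight μ)
    (hx : MemWeightedLp p μ x) (τ : ℝ) : MemWeightedLp p μ (fun s => x (s + τ)) :=
  ⟨aestronglyMeasurable_comp_add_right hμ hx.1 τ,
    (weightedNorm_comp_add_right_le hp hμ τ).trans_lt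
      (ENNReal.mul_lt_top ENNReal.ofReal_lt_top hx.2)⟩

theorem MemWeightedLp.fwdDiff (hp : 1 ≤ p) (hμ : IsWeight μ)
    (hx : MemWeightedLp p μ x) (τ : ℝ) : MemWeightedLp p μ (fwdDiff τ x) :=
  (hx.comp_add_right hp hμ τ).sub hx

theorem MemWeightedLp.fwdDiff_iterate (hp : 1 ≤ p) (hμ : IsWeight μ)
    (hx : MemWeightedLp p μ x) (τ : ℝ) (k : ℕ) :
    MemWeightedLp p μ ((_root_.fwdDiff τ)^[k] x) := by
  induction k with
  | zero => exact hx
  | succ k ih => rw [Function.iterate_succ_apply']; exact ih.fwdDiff hp hμ τ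

theorem weightedNorm_fwdDiff_le (hp : 1 ≤ p) (hμ : IsWeight μ)
    (hx : MemWeightedLp p μ x) (τ : ℝ) :
    weightedNorm p μ (fwdDiff τ x) ≤ ENNReal.ofReal (μ τ + 1) * weightedNorm p μ x := by
  refine (eLpNorm_sub_le (hx.comp_add_right hp hμ τ).1 hx.1 (one_le_ofReal_exponent hp)).trans ?_
  rw [ENNReal.ofReal_add (hμ.pos _).le zero_le_one, add_mul, ENNReal.ofReal_one, one_mul]
  exact add_le_add (weightedNorm_comp_add_right_le hp hμ τ) le_rfl

theorem weightedNorm_fwdDiff_iterate_le (hp : 1 ≤ p) (hμ : IsWeight μ)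
    (hx : MemWeightedLp p μ x) (τ : ℝ) (k : ℕ) :
    weightedNorm p μ ((fwdDiff τ)^[k] x) ≤
      ENNReal.ofReal ((μ τ + 1) ^ k) * weightedNorm p μ x := by
  have h0 : 0 ≤ μ τ + 1 := by linarith [hμ.pos τ]
  induction k with
  | zero => simp
  | succ k ih =>
    rw [Function.iterate_succ_apply', pow_succ', ENNReal.ofReal_mul h0, mul_assoc]
    exact (weightedNorm_fwdDiff_le hp hμ (hx.fwdDiff_iterate hp hμ τ k) τ).trans (by gcongr)

theorem fwdDiff_iterate_ae_congr (h : x =ᵐ[volume] y) (τ : ℝ) (k : ℕ) :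
    (fwdDiff τ)^[k] x =ᵐ[volume] (fwdDiff τ)^[k] y := by
  induction k with
  | zero => exact h
  | succ k ih =>
    rw [Function.iterate_succ_apply', Function.iterate_succ_apply']
    have h2 := (measurePreserving_add_right (volume : Measure ℝ) τ).quasiMeasurePreserving.ae ih
    filter_upwards [ih, h2] with s hs hs2
    simp only [fwdDiff, hs, hs2]

theorem modulus_congr (hμ : IsWeight μ) (h : x =ᵐ[volume] y) (k : ℕ) (t : ℝ) :
    modulus p μ k t x = modulus p μ k t y := by
  unfold modulus
  refine iSup_congr fun τ => iSup_congr fun _ => ?_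
  exact weightedNorm_congr hμ (fwdDiff_iterate_ae_congr h τ k)

end Translation

/-! ### An entire multiplier that beats the weight -/

theorem Complex.norm_cos_le_exp (w : ℂ) : ‖Complex.cos w‖ ≤ Real.exp ‖w‖ := by
  rw [Complex.cos, norm_div, Complex.norm_ofNat]
  have h1 := Complex.norm_exp_le_exp_norm (w * Complex.I)
  have h2 := Complex.norm_exp_le_exp_norm (-w * Complex.I)
  simp only [norm_mul, norm_neg, Complex.norm_I, mul_one] at h1 h2
  have := norm_add_le (Complex.exp (w * Complex.I)) (Complex.exp (-w * Complex.I))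
  linarith

theorem Complex.norm_cos_sub_one_le {w : ℂ} (hw : ‖w‖ ≤ 1) : ‖Complex.cos w - 1‖ ≤ 2 * ‖w‖ := by
  have h1 := Complex.norm_exp_sub_one_le (x := w * Complex.I) (by simpa using hw)
  have h2 := Complex.norm_exp_sub_one_le (x := -w * Complex.I) (by simpa using hw)
  simp only [norm_mul, norm_neg, Complex.norm_I, mul_one] at h1 h2
  have h3 : Complex.cos w - 1 =
      ((Complex.exp (w * Complex.I) - 1) + (Complex.exp (-w * Complex.I) - 1)) / 2 := by
    rw [Complex.cos]; ring
  rw [h3, norm_div, Complex.norm_ofNat]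
  have := norm_add_le (Complex.exp (w * Complex.I) - 1) (Complex.exp (-w * Complex.I) - 1)
  linarith

theorem norm_cos_pow_sub_one_le {w : ℂ} {N : ℕ} (h : N * (2 * ‖w‖) ≤ 1) :
    ‖Complex.cos w ^ N - 1‖ ≤ N * (4 * ‖w‖) := by
  rcases Nat.eq_zero_or_pos N with rfl | hN
  · simp
  have hN1 : (1 : ℝ) ≤ N := by exact_mod_cast hN
  have hw : ‖w‖ ≤ 1 := by nlinarith [norm_nonneg w]
  have h1 := Finset.norm_prod_one_add_sub_one_le (Finset.range N) (fun _ => Complex.cos w - 1)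
  simp only [add_sub_cancel, Finset.prod_const, Finset.card_range, Finset.sum_const,
    nsmul_eq_mul] at h1
  have h2 : (N : ℝ) * ‖Complex.cos w - 1‖ ≤ N * (2 * ‖w‖) := by
    gcongr; exact Complex.norm_cos_sub_one_le hw
  have h3 : Real.exp (N * (2 * ‖w‖)) - 1 ≤ 2 * (N * (2 * ‖w‖)) := by
    have h0 : 0 ≤ N * (2 * ‖w‖) := by positivity
    have := Real.abs_exp_sub_one_le (x := N * (2 * ‖w‖)) (by rwa [abs_of_nonneg h0])
    rw [abs_of_nonneg h0] at this
    exact (le_abs_self _).trans this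
  calc _ ≤ _ := h1
    _ ≤ Real.exp (N * (2 * ‖w‖)) - 1 := by gcongr
    _ ≤ _ := by linarith

theorem Real.abs_cos_le_exp_neg_half {x : ℝ} (h1 : 1 ≤ |x|) (h2 : |x| ≤ 2) :
    |Real.cos x| ≤ Real.exp (-(1 / 2)) := by
  have he : (5 / 9 : ℝ) ≤ Real.exp (-(1 / 2)) := by
    rw [Real.exp_neg, le_inv_comm₀ (by norm_num) (Real.exp_pos _)]
    refine abs_le_of_sq_le_sq' ?_ (by norm_num) |>.2
    rw [← Real.exp_nat_mul]
    norm_num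
    linarith [Real.exp_one_lt_d9]
  have hπ := Real.pi_gt_three
  rw [← Real.cos_abs]
  have hu : Real.cos |x| ≤ Real.cos 1 :=
    Real.cos_le_cos_of_nonneg_of_le_pi (by norm_num) (by linarith) h1
  have hl : Real.cos 2 ≤ Real.cos |x| :=
    Real.cos_le_cos_of_nonneg_of_le_pi (by positivity) (by linarith) h2
  have hc1 := Real.cos_one_le
  have hc2 : (1 / 2 : ℝ) ≤ Real.cos 1 := by
    have := Real.one_sub_sq_div_two_le_cos (x := 1)
    linarith
  have hc3 : -(1 / 2 : ℝ) ≤ Real.cos 2 := by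
    have : Real.cos 2 = 2 * Real.cos 1 ^ 2 - 1 := by
      rw [← Real.cos_two_mul]; norm_num
    nlinarith
  rw [abs_le]
  constructor <;> linarith

/-- The logarithmic integral of the weight controls the dyadic sum of `log μ`. -/
theorem IsWeight.summable_log_div_two_pow {μ : ℝ → ℝ} (hμ : IsWeight μ) :
    Summable fun i : ℕ => Real.log (μ (2 ^ (i + 1))) / 2 ^ i := by
  have hlog : ∀ t, 0 ≤ Real.log (μ t) := fun t => Real.log_nonneg (hμ.one_le t)
  set G : ℝ → ℝ := fun t => Real.log (μ t) / (1 + t ^ 2) with hG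
  have hG0 : ∀ t, 0 ≤ G t := fun t => div_nonneg (hlog t) (by positivity)
  have hGi : ∀ a b, IntervalIntegrable G volume a b := fun a b =>
    hμ.log_integrable.intervalIntegrable
  have key : ∀ i : ℕ, Real.log (μ (2 ^ (i + 1))) / 2 ^ i ≤
      16 * ∫ t in (2 : ℝ) ^ (i + 1)..2 ^ (i + 2), G t := by
    intro i
    set a : ℝ := 2 ^ i with ha
    have ha1 : 1 ≤ a := one_le_pow₀ (by norm_num)
    have e1 : (2 : ℝ) ^ (i + 1) = 2 * a := by rw [ha]; ring
    have e2 : (2 : ℝ) ^ (i + 2) = 4 * a := by rw [ha]; ring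
    rw [e1, e2]
    have hlow : ∫ _ in (2 * a)..(4 * a), Real.log (μ (2 * a)) / (1 + (4 * a) ^ 2) ≤
        ∫ t in (2 * a)..(4 * a), G t := by
      refine intervalIntegral.integral_mono_on (by linarith) (by simp) (hGi _ _) fun t ht => ?_
      have h2a : 0 < 2 * a := by linarith
      have ht0 : 0 < t := h2a.trans_le ht.1
      refine div_le_div₀ (hlog t) ?_ (by positivity) ?_
      · exact Real.log_le_log (hμ.pos _) (hμ.monotone h2a ht0 ht.1)
      · have := ht.2
        gcongr
    rw [intervalIntegral.integral_const, smul_eq_mul] at hlow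
    refine le_trans ?_ (mul_le_mul_of_nonneg_left hlow (by norm_num))
    have hL := hlog (2 * a)
    generalize Real.log (μ (2 * a)) = L at hL
    rw [mul_div_assoc', mul_div_assoc', div_le_div_iff₀ (by positivity) (by positivity)]
    nlinarith [mul_nonneg hL (by nlinarith : 0 ≤ a ^ 2 - 1)]
  refine summable_of_sum_range_le (c := 16 * ∫ t, G t)
    (fun i => div_nonneg (hlog _) (by positivity)) fun n => ?_
  calc ∑ i ∈ Finset.range n, Real.log (μ (2 ^ (i + 1))) / 2 ^ i
      ≤ ∑ i ∈ Finset.range n, 16 * ∫ t in (2 : ℝ) ^ (i + 1)..2 ^ (i + 1 + 1), G t :=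
        Finset.sum_le_sum fun i _ => key i
    _ = 16 * ∫ t in (2 : ℝ) ^ (0 + 1)..2 ^ (n + 1), G t := by
        rw [← Finset.mul_sum,
          intervalIntegral.sum_integral_adjacent_intervals (a := fun i : ℕ => (2 : ℝ) ^ (i + 1))
            fun k _ => hGi _ _]
    _ ≤ 16 * ∫ t, G t := by
        have : (2 : ℝ) ^ (0 + 1) ≤ 2 ^ (n + 1) :=
          pow_le_pow_right₀ (by norm_num) (by omega)
        rw [intervalIntegral.integral_of_le this]
        exact mul_le_mul_of_nonneg_left
          (setIntegral_le_integral hμ.log_integrable (ae_of_all _ hG0)) (by norm_num)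

/-- There is an entire function of exponential type, equal to `1` at the origin, which decays on
the real line at least as fast as the reciprocal of the weight. It is the product of
`cos (z / 2 ^ i) ^ N i`: the `i`-th factor is at most `exp (-N i / 2)` for
`2 ^ i ≤ |t| ≤ 2 ^ (i + 1)`, so `N i` is taken to be about `2 * log μ (2 ^ (i + 1))`, and the
logarithmic integral makes `∑ N i / 2 ^ i`, the type of the product, finite. -/
theorem IsWeight.exists_multiplier {μ : ℝ → ℝ} (hμ : IsWeight μ) :
    ∃ (H : ℂ → ℂ) (σ C : ℝ), 0 ≤ σ ∧ 1 ≤ C ∧ Differentiable ℂ H ∧ H 0 = 1 ∧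
      (∀ z, ‖H z‖ ≤ Real.exp (σ * ‖z‖)) ∧ ∀ t : ℝ, ‖H t‖ * μ t ≤ C := by
  set N : ℕ → ℕ := fun i => ⌈2 * Real.log (μ (2 ^ (i + 1)))⌉₊ with hN
  have hlog : ∀ t, 0 ≤ Real.log (μ t) := fun t => Real.log_nonneg (hμ.one_le t)
  have hsum : Summable fun i : ℕ => (N i : ℝ) / 2 ^ i := by
    refine Summable.of_nonneg_of_le (fun i => by positivity) (fun i => ?_)
      ((hμ.summable_log_div_two_pow.mul_left 2).add summable_geometric_two)
    have := (Nat.ceil_lt_add_one (a := 2 * Real.log (μ (2 ^ (i + 1))))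
      (mul_nonneg zero_le_two (hlog _))).le
    rw [mul_div_assoc', one_div, inv_pow, ← one_div, ← add_div]
    gcongr
  set σ : ℝ := ∑' i, (N i : ℝ) / 2 ^ i with hσ
  set φ : ℕ → ℂ → ℂ := fun i z => Complex.cos (z / 2 ^ i) ^ N i with hφ
  have hφd : ∀ i, Differentiable ℂ (φ i) := fun i => by
    simp only [hφ]
    exact (Complex.differentiable_cos.comp (differentiable_id.div_const _)).pow _
  have hnorm : ∀ (z : ℂ) (i : ℕ), ‖z / 2 ^ i‖ = ‖z‖ / 2 ^ i := fun z i => by simp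
  -- On a compact set the factors satisfy `|φ i - 1| ≤ 4 R N i / 2 ^ i` for large `i`.
  have hprod : HasProdLocallyUniformlyOn φ (fun z => ∏' i, φ i z) univ := by
    refine hasProdLocallyUniformlyOn_of_forall_compact isOpen_univ fun K _ hK => ?_
    obtain ⟨R, hR⟩ := hK.isBounded.exists_norm_le
    have h0 : ∀ᶠ i : ℕ in cofinite, 2 * max R 0 * ((N i : ℝ) / 2 ^ i) ≤ 1 :=
      ((hsum.mul_left (2 * max R 0)).tendsto_cofinite_zero).eventually_le_const one_pos
    have := (hsum.mul_left (4 * max R 0)).hasProdUniformlyOn_one_add (K := K)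
      (f := fun i z => φ i z - 1) hK ?_ fun i =>
        ((hφd i).continuous.sub continuous_const).continuousOn
    · simpa using this
    filter_upwards [h0] with i hi z hz
    have hz' : ‖z‖ ≤ max R 0 := (hR z hz).trans (le_max_left _ _)
    refine (norm_cos_pow_sub_one_le ?_).trans ?_
    · refine le_trans ?_ hi
      rw [hnorm]
      calc (N i : ℝ) * (2 * (‖z‖ / 2 ^ i)) = 2 * ‖z‖ * (N i / 2 ^ i) := by ring
        _ ≤ _ := by gcongr
    · rw [hnorm]
      calc (N i : ℝ) * (4 * (‖z‖ / 2 ^ i)) = 4 * ‖z‖ * (N i / 2 ^ i) := by ring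
        _ ≤ _ := by gcongr
  have hlim : ∀ z, Tendsto (fun n => ∏ i ∈ Finset.range n, φ i z) atTop (𝓝 (∏' i, φ i z)) :=
    fun z => (hprod.hasProd (mem_univ z)).tendsto_prod_nat
  refine ⟨fun z => ∏' i, φ i z, σ, max (max (μ 0) (μ 1)) 1, ?_, le_max_right _ _, ?_, ?_, ?_, ?_⟩
  · exact tsum_nonneg fun i => by positivity
  · rw [← differentiableOn_univ]
    refine hprod.differentiableOn (.of_forall fun s => ?_) isOpen_univ
    simpa [Finset.prod_fn] using
      DifferentiableOn.finsetProd (u := s) (f := φ) (s := univ)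
        fun i _ => (hφd i).differentiableOn
  · simp [hφ]
  · intro z
    refine le_of_tendsto (hlim z).norm (.of_forall fun n => ?_)
    rw [norm_prod]
    calc ∏ i ∈ Finset.range n, ‖φ i z‖
        ≤ ∏ i ∈ Finset.range n, Real.exp (N i / 2 ^ i * ‖z‖) := by
          refine Finset.prod_le_prod (fun _ _ => norm_nonneg _) fun i _ => ?_
          rw [hφ, norm_pow, show (N i : ℝ) / 2 ^ i * ‖z‖ = N i * ‖z / 2 ^ i‖ by rw [hnorm]; ring,
            Real.exp_nat_mul]
          gcongr
          exact Complex.norm_cos_le_exp _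
      _ = Real.exp ((∑ i ∈ Finset.range n, (N i : ℝ) / 2 ^ i) * ‖z‖) := by
          rw [← Real.exp_sum, Finset.sum_mul]
      _ ≤ _ := by
          gcongr
          exact hsum.sum_le_tsum _ fun i _ => by positivity
  · intro t
    have hle1 : ∀ i, ‖φ i t‖ ≤ 1 := fun i => by
      rw [hφ, norm_pow]
      refine pow_le_one₀ (norm_nonneg _) ?_
      have : (t : ℂ) / 2 ^ i = ((t / 2 ^ i : ℝ) : ℂ) := by push_cast; rfl
      rw [this, ← Complex.ofReal_cos, Complex.norm_real]
      exact Real.abs_cos_le_one _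
    rcases lt_or_ge |t| 1 with ht | ht
    · have h1 : ‖∏' i, φ i t‖ ≤ 1 := by
        refine le_of_tendsto (hlim t).norm (.of_forall fun n => ?_)
        rw [norm_prod]
        exact Finset.prod_le_one (fun _ _ => norm_nonneg _) fun i _ => hle1 i
      calc ‖∏' i, φ i t‖ * μ t ≤ 1 * μ t := by
            gcongr
            exact (hμ.pos t).le
        _ ≤ _ := by rw [one_mul]; exact (hμ.le_max ht.le).trans (le_max_left _ _)
    · obtain ⟨i, hi1, hi2⟩ := exists_nat_pow_near ht one_lt_two
      have hfac : ‖φ i t‖ ≤ (μ t)⁻¹ := by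
        have e : (t : ℂ) / 2 ^ i = ((t / 2 ^ i : ℝ) : ℂ) := by push_cast; rfl
        rw [hφ, norm_pow, e, ← Complex.ofReal_cos, Complex.norm_real, Real.norm_eq_abs]
        have habs : |t / 2 ^ i| = |t| / 2 ^ i := by
          rw [abs_div, abs_of_pos (by positivity : (0 : ℝ) < 2 ^ i)]
        have hc : |Real.cos (t / 2 ^ i)| ≤ Real.exp (-(1 / 2)) := by
          refine Real.abs_cos_le_exp_neg_half ?_ ?_ <;> rw [habs]
          · rwa [one_le_div (by positivity)]
          · rw [div_le_iff₀ (by positivity), ← pow_succ']; exact hi2.le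
        calc |Real.cos (t / 2 ^ i)| ^ N i ≤ Real.exp (-(1 / 2)) ^ N i := by gcongr
          _ = Real.exp (-(N i / 2)) := by rw [← Real.exp_nat_mul]; congr 1; ring
          _ ≤ Real.exp (-Real.log (μ (2 ^ (i + 1)))) := by
              gcongr
              have := Nat.le_ceil (2 * Real.log (μ (2 ^ (i + 1))))
              change 2 * Real.log (μ (2 ^ (i + 1))) ≤ (N i : ℝ) at this
              linarith
          _ ≤ (μ t)⁻¹ := by
              rw [Real.exp_neg, Real.exp_log (hμ.pos _)]
              gcongr
              · exact hμ.pos t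
              · rw [← hμ.abs_eq t]
                exact hμ.monotone (zero_lt_one.trans_le ht)
                  (show (0 : ℝ) < 2 ^ (i + 1) by positivity) hi2.le
      have h1 : ‖∏' i, φ i t‖ ≤ (μ t)⁻¹ := by
        refine le_of_tendsto (hlim t).norm ?_
        filter_upwards [eventually_gt_atTop i] with n hn
        rw [norm_prod, ← Finset.mul_prod_erase _ _ (Finset.mem_range.2 hn)]
        refine (mul_le_of_le_one_right (norm_nonneg _) ?_).trans hfac
        exact Finset.prod_le_one (fun _ _ => norm_nonneg _) fun i _ => hle1 i
      calc ‖∏' i, φ i t‖ * μ t ≤ (μ t)⁻¹ * μ t := by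
            gcongr
            exact (hμ.pos t).le
        _ = 1 := inv_mul_cancel₀ (hμ.pos t).ne'
        _ ≤ _ := le_max_right _ _

/-! ### Bernstein's inequality in the weighted space -/

section PhragmenLindelof

variable {E : Type*} [NormedAddCommGroup E] [NormedSpace ℂ E]

theorem norm_le_exp_mul_re_of_bounded_on_imaginary_axis {G : ℂ → E} (hG : Differentiable ℂ G)
    {A R B : ℝ} (hA : ∀ z, ‖G z‖ ≤ A * Real.exp (R * ‖z‖))
    (hB : ∀ t : ℝ, ‖G (t * Complex.I)‖ ≤ B) {z : ℂ} (hz : 0 ≤ z.re) :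
    ‖G z‖ ≤ B * Real.exp ((R + 1) * z.re) := by
  -- The extra `1` in the exponent makes the function tend to zero along the positive axis.
  set f : ℂ → E := fun w => Complex.exp (-((R + 1 : ℝ) * w)) • G w with hf
  have hfn : ∀ w, ‖f w‖ = Real.exp (-((R + 1) * w.re)) * ‖G w‖ := fun w => by
    rw [hf, norm_smul, Complex.norm_exp]
    simp
  have hfd : Differentiable ℂ f := by
    refine Differentiable.smul ?_ hG
    fun_prop
  have hA0 : 0 ≤ A := by simpa using (norm_nonneg _).trans (hA 0)
  have key : ‖f z‖ ≤ B := by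
    refine PhragmenLindelof.right_half_plane_of_tendsto_zero_on_real hfd.diffContOnCl
      ⟨1, one_lt_two, |R + 1| + R, ?_⟩ ?_ ?_ hz
    · refine Asymptotics.IsBigO.of_bound A (.of_forall fun w => ?_)
      rw [hfn, Real.rpow_one, Real.norm_of_nonneg (Real.exp_pos _).le,
        add_mul |R + 1|, Real.exp_add]
      have h1 : -((R + 1) * w.re) ≤ |R + 1| * ‖w‖ := by
        refine (neg_le_abs _).trans ?_
        rw [abs_mul]
        gcongr
        exact Complex.abs_re_le_norm w
      calc Real.exp (-((R + 1) * w.re)) * ‖G w‖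
          ≤ Real.exp (|R + 1| * ‖w‖) * (A * Real.exp (R * ‖w‖)) := by
            gcongr
            exact hA w
        _ = _ := by ring
    · have h0 : Tendsto (fun x : ℝ => A * Real.exp (-x)) atTop (𝓝 0) := by
        simpa using (Real.tendsto_exp_neg_atTop_nhds_zero).const_mul A
      refine squeeze_zero_norm' ?_ h0
      filter_upwards [eventually_ge_atTop 0] with x hx
      rw [hfn, Complex.ofReal_re]
      have h2 := hA x
      rw [Complex.norm_real, Real.norm_of_nonneg hx] at h2
      calc Real.exp (-((R + 1) * x)) * ‖G x‖
          ≤ Real.exp (-((R + 1) * x)) * (A * Real.exp (R * x)) := by gcongr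
        _ = A * (Real.exp (-((R + 1) * x)) * Real.exp (R * x)) := by ring
        _ = A * Real.exp (-x) := by rw [← Real.exp_add]; congr 2; ring
    · intro t
      rw [hfn]
      simpa using hB t
  rw [hfn, Real.exp_neg, inv_mul_le_iff₀ (Real.exp_pos _)] at key
  linarith

/-- An entire function of exponential type that is bounded by `B` on the real line is bounded by
`B * exp ((R + 1) * |Im z|)`. -/
theorem norm_le_exp_mul_abs_im_of_bounded_on_real {G : ℂ → E} (hG : Differentiable ℂ G)
    {A R B : ℝ} (hA : ∀ z, ‖G z‖ ≤ A * Real.exp (R * ‖z‖))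
    (hB : ∀ t : ℝ, ‖G t‖ ≤ B) (z : ℂ) :
    ‖G z‖ ≤ B * Real.exp ((R + 1) * |z.im|) := by
  rcases le_total 0 z.im with h | h
  · have := norm_le_exp_mul_re_of_bounded_on_imaginary_axis (G := fun w => G (Complex.I * w))
      (hG.comp (differentiable_id.const_mul _)) (A := A) (R := R) (B := B)
      (fun w => by simpa using hA (Complex.I * w))
      (fun t => by
        have := hB (-t)
        rwa [show ((-t : ℝ) : ℂ) = Complex.I * (t * Complex.I) by
          push_cast; linear_combination -(t : ℂ) * Complex.I_mul_I] at this)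
      (z := -Complex.I * z) (by simpa using h)
    have e : Complex.I * (-Complex.I * z) = z := by linear_combination -z * Complex.I_mul_I
    simp only [e] at this
    simpa [abs_of_nonneg h] using this
  · have := norm_le_exp_mul_re_of_bounded_on_imaginary_axis (G := fun w => G (-Complex.I * w))
      (hG.comp (differentiable_id.const_mul _)) (A := A) (R := R) (B := B)
      (fun w => by simpa using hA (-Complex.I * w))
      (fun t => by
        have := hB t
        rwa [show (t : ℂ) = -Complex.I * (t * Complex.I) by
          linear_combination (t : ℂ) * Complex.I_mul_I] at this)
      (z := Complex.I * z) (by simpa using h)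
    have e : -Complex.I * (Complex.I * z) = z := by linear_combination -z * Complex.I_mul_I
    rw [e] at this
    simpa [abs_of_nonpos h] using this

end PhragmenLindelof

/-- The elements of the weighted space that are restrictions of entire functions of exponential
type at most `r`. -/
def BandLimited (p : ℝ) (μ : ℝ → ℝ) (r : ℝ) (F : ℂ → ℂ) : Prop :=
  IsEntireOfExpType r F ∧ MemWeightedLp p μ (fun s : ℝ => F (s : ℂ))

/-- The weighted measure restricted to the window `[-T, T]`. -/
noncomputable def windowMeasure (p : ℝ) (μ : ℝ → ℝ) (T : ℝ) : Measure ℝ :=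
  (weightMeasure p μ).restrict (Icc (-T) T)

section Window

variable {p : ℝ} {μ : ℝ → ℝ}

theorem isFiniteMeasure_windowMeasure (hp : 1 ≤ p) (hμ : IsWeight μ) (T : ℝ) :
    IsFiniteMeasure (windowMeasure p μ T) :=
  ⟨by
    rw [windowMeasure, Measure.restrict_apply_univ]
    exact hμ.weightMeasure_Icc_lt_top (by linarith) T⟩

theorem ae_windowMeasure_mem (p : ℝ) (μ : ℝ → ℝ) (T : ℝ) :
    ∀ᵐ s ∂windowMeasure p μ T, |s| ≤ T := by
  filter_upwards [ae_restrict_mem measurableSet_Icc] with s hs using abs_le.2 hs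

theorem memLp_windowMeasure (hp : 1 ≤ p) (hμ : IsWeight μ) (T : ℝ) {F : ℂ → ℂ}
    (hF : Continuous F) (z : ℂ) :
    MemLp (fun s : ℝ => F (s + z)) (ENNReal.ofReal p) (windowMeasure p μ T) := by
  have := isFiniteMeasure_windowMeasure hp hμ T
  have hc : Continuous fun s : ℝ => F (s + z) := by fun_prop
  obtain ⟨C, hC⟩ := (isCompact_Icc (a := -T) (b := T)).exists_bound_of_continuousOn hc.continuousOn
  refine MemLp.of_bound hc.aestronglyMeasurable C ?_
  filter_upwards [ae_windowMeasure_mem p μ T] with s hs using hC s (abs_le.1 hs)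

/-- The translate `s ↦ F (s + z)` by a complex number `z`, restricted to the window `[-T, T]`.
The window makes this an element of `L_p` for every `z`. -/
noncomputable def windowTranslate (hp : 1 ≤ p) (hμ : IsWeight μ) (T : ℝ) {F : ℂ → ℂ}
    (hF : Continuous F) (z : ℂ) : Lp ℂ (ENNReal.ofReal p) (windowMeasure p μ T) :=
  (memLp_windowMeasure hp hμ T hF z).toLp _

theorem continuous_deriv_of_differentiable {F : ℂ → ℂ} (hF : Differentiable ℂ F) :
    Continuous (deriv F) :=
  (hF.contDiff (n := 1)).continuous_deriv le_rfl

theorem hasDerivAt_windowTranslate (hp : 1 ≤ p) (hμ : IsWeight μ) (T : ℝ) {F : ℂ → ℂ}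
    (hF : Differentiable ℂ F) [Fact (1 ≤ ENNReal.ofReal p)] (z : ℂ) :
    HasDerivAt (windowTranslate hp hμ T hF.continuous)
      (windowTranslate hp hμ T (continuous_deriv_of_differentiable hF) z) z := by
  have := isFiniteMeasure_windowMeasure hp hμ T
  rw [hasDerivAt_iff_isLittleO, Asymptotics.isLittleO_iff]
  intro c hc
  set V : ℝ :=
    ((measureUnivNNReal (windowMeasure p μ T) ^ (ENNReal.ofReal p).toReal⁻¹ : NNReal) : ℝ)
    with hV
  have hV0 : 0 ≤ V := NNReal.coe_nonneg _
  have hc' : 0 < c / (V + 1) := by positivity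
  have huc := (isCompact_closedBall (0 : ℂ) (|T| + ‖z‖ + 1)).uniformContinuousOn_of_continuous
    (continuous_deriv_of_differentiable hF).continuousOn
  obtain ⟨δ, hδ, H⟩ := Metric.uniformContinuousOn_iff.1 huc _ hc'
  filter_upwards [Metric.ball_mem_nhds z (lt_min hδ one_pos)] with w hw
  have hb : ‖windowTranslate hp hμ T hF.continuous w - windowTranslate hp hμ T hF.continuous z -
      (w - z) • windowTranslate hp hμ T (continuous_deriv_of_differentiable hF) z‖ ≤
      V * (c / (V + 1) * ‖w - z‖) := by
    refine Lp.norm_le_of_ae_bound (by positivity) ?_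
    filter_upwards [ae_windowMeasure_mem p μ T,
      Lp.coeFn_sub (windowTranslate hp hμ T hF.continuous w -
        windowTranslate hp hμ T hF.continuous z)
        ((w - z) • windowTranslate hp hμ T (continuous_deriv_of_differentiable hF) z),
      Lp.coeFn_sub (windowTranslate hp hμ T hF.continuous w)
        (windowTranslate hp hμ T hF.continuous z),
      Lp.coeFn_smul (w - z) (windowTranslate hp hμ T (continuous_deriv_of_differentiable hF) z),
      (memLp_windowMeasure hp hμ T hF.continuous w).coeFn_toLp,
      (memLp_windowMeasure hp hμ T hF.continuous z).coeFn_toLp,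
      (memLp_windowMeasure hp hμ T (continuous_deriv_of_differentiable hF) z).coeFn_toLp]
      with s hs h1 h2 h3 h4 h5 h6
    rw [h1, Pi.sub_apply, h2, Pi.sub_apply, h3, Pi.smul_apply]
    simp only [windowTranslate]
    rw [h4, h5, h6, smul_eq_mul]
    have hmv := (convex_ball ((s : ℂ) + z) (min δ 1)).norm_image_sub_le_of_norm_hasDerivWithin_le
      (f := fun ζ => F ζ - ζ * deriv F (s + z)) (f' := fun ζ => deriv F ζ - deriv F (s + z))
      (C := c / (V + 1)) (x := s + z) (y := s + w) (fun ζ _ => ?_) (fun ζ hζ => ?_)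
      (Metric.mem_ball_self (lt_min hδ one_pos)) (by simpa [dist_eq_norm] using hw)
    · convert hmv using 2 <;> ring_nf
    · have h7 := ((hF ζ).hasDerivAt.sub ((hasDerivAt_id ζ).mul_const (deriv F (s + z))))
      rw [one_mul] at h7
      exact h7.hasDerivWithinAt
    · rw [← dist_eq_norm]
      have hs' : |s| ≤ |T| := hs.trans (le_abs_self T)
      have hd := Metric.mem_ball.1 hζ
      have hsz : ‖(s : ℂ) + z‖ ≤ |T| + ‖z‖ := (norm_add_le _ _).trans (by
        rw [Complex.norm_real, Real.norm_eq_abs]; gcongr)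
      refine (H ζ ?_ (s + z) ?_ (hd.trans_le (min_le_left _ _))).le
      · rw [mem_closedBall_zero_iff]
        have h8 : ‖ζ - (s + z)‖ < 1 := by
          rw [← dist_eq_norm]; exact hd.trans_le (min_le_right _ _)
        calc ‖ζ‖ = ‖(ζ - (s + z)) + (s + z)‖ := by ring_nf
          _ ≤ 1 + (|T| + ‖z‖) := (norm_add_le _ _).trans (add_le_add h8.le hsz)
          _ = _ := by ring
      · rw [mem_closedBall_zero_iff]; linarith
  refine hb.trans ?_
  rw [← mul_assoc]
  gcongr
  rw [mul_div_assoc', div_le_iff₀ (by positivity)]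
  nlinarith

theorem norm_windowTranslate_ofReal_le (hp : 1 ≤ p) (hμ : IsWeight μ) (T : ℝ) {F : ℂ → ℂ}
    (hF : Continuous F) (hFp : MemWeightedLp p μ fun s : ℝ => F s) (t : ℝ) :
    ‖windowTranslate hp hμ T hF t‖ ≤ μ t * (weightedNorm p μ fun s : ℝ => F s).toReal := by
  rw [windowTranslate, Lp.norm_toLp, ← ENNReal.toReal_ofReal (hμ.pos t).le, ← ENNReal.toReal_mul]
  refine ENNReal.toReal_mono (ENNReal.mul_ne_top ENNReal.ofReal_ne_top hFp.2.ne) ?_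
  refine (eLpNorm_mono_measure _ Measure.restrict_le_self).trans ?_
  simpa [weightedNorm] using
    weightedNorm_comp_add_right_le (x := fun s : ℝ => F s) hp hμ t

/-- Exponential growth of the window translate; the constant depends on the window. -/
theorem exists_norm_windowTranslate_le (hp : 1 ≤ p) (hμ : IsWeight μ) (T : ℝ) {F : ℂ → ℂ}
    {r : ℝ} (hr : 0 ≤ r) (hF : IsEntireOfExpType r F) [Fact (1 ≤ ENNReal.ofReal p)] :
    ∃ A, ∀ z, ‖windowTranslate hp hμ T hF.1.continuous z‖ ≤ A * Real.exp ((r + 1) * ‖z‖) := by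
  have := isFiniteMeasure_windowMeasure hp hμ T
  obtain ⟨C, hC⟩ := hF.2 1 one_pos
  have hC0 : 0 ≤ C := by simpa using (norm_nonneg _).trans (hC 0)
  refine ⟨(measureUnivNNReal (windowMeasure p μ T) ^ (ENNReal.ofReal p).toReal⁻¹ : NNReal) *
    (C * Real.exp ((r + 1) * T)), fun z => ?_⟩
  rw [mul_assoc]
  refine Lp.norm_le_of_ae_bound (by positivity) ?_
  filter_upwards [ae_windowMeasure_mem p μ T,
    (memLp_windowMeasure hp hμ T hF.1.continuous z).coeFn_toLp] with s hs h1
  rw [windowTranslate, h1]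
  refine (hC _).trans ?_
  rw [mul_assoc, ← Real.exp_add, ← mul_add]
  gcongr
  refine (norm_add_le _ _).trans ?_
  rw [Complex.norm_real, Real.norm_eq_abs]
  gcongr

/-- A bound for the `L_p` norms over all windows is a bound for the weighted norm. -/
theorem weightedNorm_le_of_forall_window {x : ℝ → ℂ}
    (hx : AEStronglyMeasurable x (weightMeasure p μ)) {B : ℝ≥0∞}
    (h : ∀ T : ℝ, eLpNorm x (ENNReal.ofReal p) (windowMeasure p μ T) ≤ B) :
    weightedNorm p μ x ≤ B := by
  have hlim : ∀ s, Tendsto (fun n : ℕ => (Icc (-(n : ℝ)) n).indicator x s) atTop (𝓝 (x s)) := by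
    intro s
    refine tendsto_const_nhds.congr' ?_
    filter_upwards [eventually_ge_atTop ⌈|s|⌉₊] with n hn
    rw [indicator_of_mem]
    exact abs_le.1 ((Nat.le_ceil _).trans (by exact_mod_cast hn))
  refine (Lp.eLpNorm_lim_le_liminf_eLpNorm (fun n : ℕ => hx.indicator measurableSet_Icc) x
    (ae_of_all _ hlim)).trans ?_
  refine liminf_le_of_le (by isBoundedDefault) fun b hb => ?_
  obtain ⟨n, hn⟩ := hb.exists
  refine hn.trans ?_
  rw [eLpNorm_indicator_eq_eLpNorm_restrict measurableSet_Icc]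
  exact h n

/-- Bernstein's inequality. For `F` of type `r`, the product of the multiplier of the weight with
the vector-valued function `z ↦ F (· + z)` is bounded on the real line, hence on the circle
`|z| = 1 / r` by Phragmén–Lindelöf, and Cauchy's estimate at `0` bounds `F'`. -/
theorem exists_weightedNorm_deriv_le (hp : 1 ≤ p) (hμ : IsWeight μ) :
    ∃ K : ℝ, 0 ≤ K ∧ ∀ (r : ℝ) (F : ℂ → ℂ), 1 ≤ r → BandLimited p μ r F →
      weightedNorm p μ (fun s : ℝ => deriv F s) ≤
        ENNReal.ofReal (K * r) * weightedNorm p μ (fun s : ℝ => F s) := by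
  have hfact : Fact (1 ≤ ENNReal.ofReal p) := ⟨one_le_ofReal_exponent hp⟩
  obtain ⟨H, σ, C, hσ, hC1, hHd, hH0, hHg, hHμ⟩ := hμ.exists_multiplier
  refine ⟨C * Real.exp (σ + 3) + ‖deriv H 0‖ * μ 0,
    add_nonneg (by positivity) (mul_nonneg (norm_nonneg _) (hμ.pos _).le), fun r F hr hF => ?_⟩
  have hr0 : 0 < r := by linarith
  set a : ℝ := (weightedNorm p μ fun s : ℝ => F s).toReal with ha
  have ha0 : 0 ≤ a := ENNReal.toReal_nonneg
  have hcd := continuous_deriv_of_differentiable hF.1.1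
  refine weightedNorm_le_of_forall_window
    (hcd.comp Complex.continuous_ofReal).aestronglyMeasurable fun T => ?_
  set Φ := windowTranslate hp hμ T hF.1.1.continuous with hΦ
  have hΦd : ∀ z, HasDerivAt Φ (windowTranslate hp hμ T hcd z) z :=
    hasDerivAt_windowTranslate hp hμ T hF.1.1
  set G := fun z => H z • Φ z with hG
  have hGd : Differentiable ℂ G := hHd.smul fun z => (hΦd z).differentiableAt
  obtain ⟨A, hA⟩ := exists_norm_windowTranslate_le hp hμ T hr0.le hF.1
  have hGA : ∀ z, ‖G z‖ ≤ A * Real.exp ((r + 1 + σ) * ‖z‖) := fun z => by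
    rw [hG, norm_smul]
    calc ‖H z‖ * ‖Φ z‖ ≤ Real.exp (σ * ‖z‖) * (A * Real.exp ((r + 1) * ‖z‖)) := by
          gcongr
          · exact hHg z
          · exact hA z
      _ = A * (Real.exp ((r + 1) * ‖z‖) * Real.exp (σ * ‖z‖)) := by ring
      _ = _ := by rw [← Real.exp_add, ← add_mul]
  have hGB : ∀ t : ℝ, ‖G t‖ ≤ C * a := fun t => by
    rw [hG, norm_smul]
    calc ‖H t‖ * ‖Φ t‖ ≤ ‖H t‖ * (μ t * a) := by
          gcongr
          exact norm_windowTranslate_ofReal_le hp hμ T hF.1.1.continuous hF.2 t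
      _ = ‖H t‖ * μ t * a := by ring
      _ ≤ C * a := by gcongr; exact hHμ t
  have hGz := norm_le_exp_mul_abs_im_of_bounded_on_real hGd hGA hGB
  have hG' : ‖deriv G 0‖ ≤ C * a * Real.exp (σ + 3) / (1 / r) := by
    refine Complex.norm_deriv_le_of_forall_mem_sphere_norm_le (by positivity)
      hGd.diffContOnCl fun z hz => ?_
    rw [mem_sphere_zero_iff_norm] at hz
    refine (hGz z).trans ?_
    gcongr
    calc (r + 1 + σ + 1) * |z.im| ≤ (r + 1 + σ + 1) * (1 / r) := by
          gcongr
          exact (Complex.abs_im_le_norm z).trans hz.le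
      _ ≤ σ + 3 := by
          rw [mul_one_div, div_le_iff₀ hr0]
          nlinarith
  have hGderiv : deriv G 0 = windowTranslate hp hμ T hcd 0 + deriv H 0 • Φ 0 := by
    have := ((hHd 0).hasDerivAt.smul (hΦd 0)).deriv
    rw [hH0, one_smul] at this
    exact this
  have hfin : ‖windowTranslate hp hμ T hcd 0‖ ≤
      (C * Real.exp (σ + 3) + ‖deriv H 0‖ * μ 0) * r * a := by
    have h1 : windowTranslate hp hμ T hcd 0 = deriv G 0 - deriv H 0 • Φ 0 := by
      rw [hGderiv, add_sub_cancel_right]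
    have h2 : ‖Φ 0‖ ≤ μ 0 * a := by
      simpa using norm_windowTranslate_ofReal_le hp hμ T hF.1.1.continuous hF.2 0
    rw [h1]
    calc _ ≤ ‖deriv G 0‖ + ‖deriv H 0‖ * ‖Φ 0‖ := by
          rw [← norm_smul]; exact norm_sub_le _ _
      _ ≤ C * a * Real.exp (σ + 3) / (1 / r) + ‖deriv H 0‖ * (μ 0 * a) * r := by
          refine add_le_add hG' ?_
          exact (mul_le_mul_of_nonneg_left h2 (norm_nonneg (deriv H 0))).trans
            (le_mul_of_one_le_right
            (mul_nonneg (norm_nonneg _) (mul_nonneg (hμ.pos _).le ha0)) hr)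
      _ = _ := by field_simp
  rw [windowTranslate, Lp.norm_toLp] at hfin
  simp only [add_zero] at hfin
  have hne : eLpNorm (fun s : ℝ => deriv F s) (ENNReal.ofReal p) (windowMeasure p μ T) ≠ ∞ := by
    simpa using (memLp_windowMeasure hp hμ T hcd 0).2.ne
  change eLpNorm (fun s : ℝ => deriv F s) _ _ ≤ _
  rw [← ENNReal.ofReal_toReal hne]
  have hFne : weightedNorm p μ (fun s : ℝ => F s) ≠ ∞ := hF.2.2.ne
  rw [← ENNReal.ofReal_toReal hFne, ← ENNReal.ofReal_mul
    (mul_nonneg (add_nonneg (by positivity) (mul_nonneg (norm_nonneg _) (hμ.pos _).le)) hr0.le)]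
  exact ENNReal.ofReal_le_ofReal hfin

theorem BandLimited.mono {r r' : ℝ} {F : ℂ → ℂ} (hF : BandLimited p μ r F) (h : r ≤ r') :
    BandLimited p μ r' F := by
  refine ⟨⟨hF.1.1, fun ε hε => ?_⟩, hF.2⟩
  obtain ⟨C, hC⟩ := hF.1.2 ε hε
  have hC0 : 0 ≤ C := by simpa using (norm_nonneg _).trans (hC 0)
  refine ⟨C, fun z => (hC z).trans ?_⟩
  gcongr

theorem BandLimited.sub {r : ℝ} {F G : ℂ → ℂ} (hF : BandLimited p μ r F)
    (hG : BandLimited p μ r G) : BandLimited p μ r (fun z => F z - G z) := by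
  refine ⟨⟨hF.1.1.sub hG.1.1, fun ε hε => ?_⟩, hF.2.sub hG.2⟩
  obtain ⟨C, hC⟩ := hF.1.2 ε hε
  obtain ⟨D, hD⟩ := hG.1.2 ε hε
  refine ⟨C + D, fun z => (norm_sub_le _ _).trans ?_⟩
  rw [add_mul]
  exact add_le_add (hC z) (hD z)

theorem IsEntireOfExpType.comp_add {r : ℝ} (hr : 0 ≤ r) {F : ℂ → ℂ} (hF : IsEntireOfExpType r F)
    (w : ℂ) : IsEntireOfExpType r (fun z => F (z + w)) := by
  refine ⟨hF.1.comp (differentiable_id.add_const w), fun ε hε => ?_⟩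
  obtain ⟨C, hC⟩ := hF.2 ε hε
  have hC0 : 0 ≤ C := by simpa using (norm_nonneg _).trans (hC 0)
  refine ⟨C * Real.exp ((r + ε) * ‖w‖), fun z => (hC _).trans ?_⟩
  rw [mul_assoc, ← Real.exp_add, ← mul_add, add_comm ‖w‖]
  gcongr
  exact norm_add_le z w

theorem IsEntireOfExpType.deriv {r : ℝ} (hr : 0 ≤ r) {F : ℂ → ℂ} (hF : IsEntireOfExpType r F) :
    IsEntireOfExpType r (deriv F) := by
  refine ⟨fun z => (hF.1.analyticAt z).deriv.differentiableAt, fun ε hε => ?_⟩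
  obtain ⟨C, hC⟩ := hF.2 ε hε
  have hC0 : 0 ≤ C := by simpa using (norm_nonneg _).trans (hC 0)
  refine ⟨C * Real.exp (r + ε), fun z => ?_⟩
  have := Complex.norm_deriv_le_of_forall_mem_sphere_norm_le (c := z) (R := 1) one_pos
    hF.1.diffContOnCl (C := C * Real.exp ((r + ε) * (1 + ‖z‖))) fun w hw => (hC w).trans ?_
  · rw [div_one, mul_add, mul_one, Real.exp_add, ← mul_assoc] at this
    exact this
  · gcongr
    calc ‖w‖ = ‖(w - z) + z‖ := by ring_nf
      _ ≤ 1 + ‖z‖ := (norm_add_le _ _).trans (by rw [mem_sphere_iff_norm.1 hw])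

theorem fwdDiff_comp_ofReal (F : ℂ → ℂ) (τ : ℝ) :
    fwdDiff τ (fun s : ℝ => F s) = fun s : ℝ => fwdDiff (τ : ℂ) F s := by
  funext s
  simp [fwdDiff]

theorem BandLimited.fwdDiff (hp : 1 ≤ p) (hμ : IsWeight μ) {r : ℝ} (hr : 0 ≤ r) {F : ℂ → ℂ}
    (hF : BandLimited p μ r F) (τ : ℝ) : BandLimited p μ r (fwdDiff (τ : ℂ) F) := by
  have h : BandLimited p μ r (fun z => F (z + τ)) :=
    ⟨hF.1.comp_add hr τ, by simpa using hF.2.comp_add_right hp hμ τ⟩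
  exact h.sub hF

/-- The mean value inequality for the translation group. -/
theorem weightedNorm_fwdDiff_le_mul_deriv (hp : 1 ≤ p) (hμ : IsWeight μ) {r : ℝ} {F : ℂ → ℂ}
    (hF : BandLimited p μ r F) (hF' : MemWeightedLp p μ fun s : ℝ => deriv F s) {τ : ℝ}
    (h0 : 0 ≤ τ) (h1 : τ ≤ 1) :
    weightedNorm p μ (fwdDiff τ fun s : ℝ => F s) ≤
      ENNReal.ofReal (max (μ 0) (μ 1) * τ) * weightedNorm p μ (fun s : ℝ => deriv F s) := by
  have hfact : Fact (1 ≤ ENNReal.ofReal p) := ⟨one_le_ofReal_exponent hp⟩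
  have hcd := continuous_deriv_of_differentiable hF.1.1
  have hM0 : 0 ≤ max (μ 0) (μ 1) := (hμ.pos 0).le.trans (le_max_left _ _)
  refine weightedNorm_le_of_forall_window (hF.2.fwdDiff hp hμ τ).1 fun T => ?_
  set Φ := windowTranslate hp hμ T hF.1.1.continuous with hΦ
  set b := (weightedNorm p μ fun s : ℝ => deriv F s).toReal with hb
  have key : ‖Φ τ - Φ (0 : ℝ)‖ ≤ max (μ 0) (μ 1) * b * ‖τ - 0‖ := by
    refine (convex_Icc 0 τ).norm_image_sub_le_of_norm_hasDerivWithin_le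
      (f := fun t : ℝ => Φ t) (f' := fun t : ℝ => windowTranslate hp hμ T hcd t)
      (fun t _ => ?_) (fun t ht => ?_) (left_mem_Icc.2 h0) (right_mem_Icc.2 h0)
    · have := (hasDerivAt_windowTranslate hp hμ T hF.1.1 (t : ℂ)).scomp t
        Complex.ofRealCLM.hasDerivAt
      rw [Complex.ofRealCLM_apply, Complex.ofReal_one, one_smul] at this
      exact this.hasDerivWithinAt
    · refine (norm_windowTranslate_ofReal_le hp hμ T hcd hF' t).trans ?_
      gcongr
      exact hμ.le_max ((abs_of_nonneg ht.1).le.trans (ht.2.trans h1))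
  rw [sub_zero, Real.norm_of_nonneg h0, hΦ, windowTranslate, windowTranslate, ← MemLp.toLp_sub,
    Lp.norm_toLp] at key
  have hne : eLpNorm (_root_.fwdDiff τ fun s : ℝ => F s) (ENNReal.ofReal p)
      (windowMeasure p μ T) ≠ ∞ :=
    ((eLpNorm_mono_measure _ Measure.restrict_le_self).trans_lt (hF.2.fwdDiff hp hμ τ).2).ne
  have he : ((fun s : ℝ => F (s + τ)) - fun s : ℝ => F (s + (0 : ℝ))) =
      _root_.fwdDiff τ fun s : ℝ => F s := by
    funext s; simp [_root_.fwdDiff]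
  rw [he] at key
  have hne' : weightedNorm p μ (fun s : ℝ => deriv F s) ≠ ∞ := hF'.2.ne
  rw [← ENNReal.ofReal_toReal hne, ← ENNReal.ofReal_toReal hne',
    ← ENNReal.ofReal_mul (by positivity)]
  refine ENNReal.ofReal_le_ofReal (key.trans (le_of_eq ?_))
  ring

end Window

/-- Bernstein's inequality and its analogue for differences, with a common constant. -/
structure BernsteinBound (p : ℝ) (μ : ℝ → ℝ) (K : ℝ) : Prop where
  nonneg : 0 ≤ K
  deriv_le : ∀ {r : ℝ} {F : ℂ → ℂ}, 1 ≤ r → BandLimited p μ r F →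
    weightedNorm p μ (fun s : ℝ => deriv F s) ≤
      ENNReal.ofReal (K * r) * weightedNorm p μ (fun s : ℝ => F s)
  fwdDiff_le : ∀ {r τ : ℝ} {F : ℂ → ℂ}, 1 ≤ r → 0 ≤ τ → τ ≤ 1 → BandLimited p μ r F →
    weightedNorm p μ (fwdDiff τ fun s : ℝ => F s) ≤
      ENNReal.ofReal (K * r * τ) * weightedNorm p μ (fun s : ℝ => F s)

section Bernstein

variable {p K : ℝ} {μ : ℝ → ℝ}

theorem exists_bernsteinBound (hp : 1 ≤ p) (hμ : IsWeight μ) : ∃ K, BernsteinBound p μ K := by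
  obtain ⟨K, hK, h⟩ := exists_weightedNorm_deriv_le hp hμ
  have hM : 1 ≤ max (μ 0) (μ 1) := (hμ.one_le 0).trans (le_max_left _ _)
  have hM0 : 0 ≤ max (μ 0) (μ 1) := by linarith
  refine ⟨max (μ 0) (μ 1) * K, by positivity, fun {r F} hr hF => ?_, fun {r τ F} hr h0 h1 hF => ?_⟩
  · refine (h r F hr hF).trans ?_
    gcongr
    exact le_mul_of_one_le_left hK hM
  · have hd := h r F hr hF
    have hF' : MemWeightedLp p μ fun s : ℝ => deriv F s :=
      ⟨((continuous_deriv_of_differentiable hF.1.1).comp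
        Complex.continuous_ofReal).aestronglyMeasurable,
        hd.trans_lt (ENNReal.mul_lt_top ENNReal.ofReal_lt_top hF.2.2)⟩
    refine (weightedNorm_fwdDiff_le_mul_deriv hp hμ hF hF' h0 h1).trans ?_
    calc _ ≤ ENNReal.ofReal (max (μ 0) (μ 1) * τ) *
          (ENNReal.ofReal (K * r) * weightedNorm p μ (fun s : ℝ => F s)) := by gcongr
      _ = _ := by
        rw [← mul_assoc, ← ENNReal.ofReal_mul (by positivity)]
        congr 2
        ring

theorem BandLimited.deriv (hK : BernsteinBound p μ K) {r : ℝ} (hr : 1 ≤ r) {F : ℂ → ℂ}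
    (hF : BandLimited p μ r F) : BandLimited p μ r (deriv F) :=
  ⟨hF.1.deriv (by linarith),
    ((continuous_deriv_of_differentiable hF.1.1).comp
      Complex.continuous_ofReal).aestronglyMeasurable,
    (hK.deriv_le hr hF).trans_lt (ENNReal.mul_lt_top ENNReal.ofReal_lt_top hF.2.2)⟩

theorem BandLimited.iterate_deriv (hK : BernsteinBound p μ K) {r : ℝ} (hr : 1 ≤ r) {F : ℂ → ℂ}
    (hF : BandLimited p μ r F) (i : ℕ) : BandLimited p μ r (_root_.deriv^[i] F) := by
  induction i with
  | zero => exact hF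
  | succ i ih => rw [Function.iterate_succ_apply']; exact ih.deriv hK hr

theorem BernsteinBound.iterate_deriv_le (hK : BernsteinBound p μ K) {r : ℝ} (hr : 1 ≤ r)
    {F : ℂ → ℂ} (hF : BandLimited p μ r F) (i : ℕ) :
    weightedNorm p μ (fun s : ℝ => deriv^[i] F s) ≤
      ENNReal.ofReal ((K * r) ^ i) * weightedNorm p μ (fun s : ℝ => F s) := by
  have hKr : 0 ≤ K * r := mul_nonneg hK.nonneg (by linarith)
  induction i with
  | zero => simp
  | succ i ih =>
    rw [Function.iterate_succ_apply', pow_succ', ENNReal.ofReal_mul hKr, mul_assoc]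
    exact (hK.deriv_le hr (hF.iterate_deriv hK hr i)).trans (by gcongr)

theorem BernsteinBound.fwdDiff_iterate_le (hp : 1 ≤ p) (hμ : IsWeight μ)
    (hK : BernsteinBound p μ K) {r τ : ℝ} (hr : 1 ≤ r) (h0 : 0 ≤ τ) (h1 : τ ≤ 1) (k : ℕ)
    {F : ℂ → ℂ} (hF : BandLimited p μ r F) :
    weightedNorm p μ ((fwdDiff τ)^[k] fun s : ℝ => F s) ≤
      ENNReal.ofReal ((K * r * τ) ^ k) * weightedNorm p μ (fun s : ℝ => F s) := by
  have hKr : 0 ≤ K * r * τ := mul_nonneg (mul_nonneg hK.nonneg (by linarith)) h0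
  induction k generalizing F with
  | zero => simp
  | succ k ih =>
    rw [Function.iterate_succ_apply, fwdDiff_comp_ofReal]
    refine (ih (hF.fwdDiff hp hμ (by linarith) τ)).trans ?_
    rw [pow_succ, ENNReal.ofReal_mul (by positivity), mul_assoc (ENNReal.ofReal _),
      ← fwdDiff_comp_ofReal]
    gcongr
    exact hK.fwdDiff_le hr h0 h1 hF

end Bernstein

/-! ### The differentiation operator is closed and single-valued -/

theorem absolutelyContinuousOnInterval_of_dist_le {X Y : Type*} [PseudoMetricSpace X]
    [PseudoMetricSpace Y] {f : ℝ → X} {u : ℝ → Y} {a b : ℝ}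
    (hu : AbsolutelyContinuousOnInterval u a b) (h : ∀ s t, dist (f s) (f t) ≤ dist (u s) (u t)) :
    AbsolutelyContinuousOnInterval f a b :=
  squeeze_zero (fun _ => Finset.sum_nonneg fun _ _ => dist_nonneg)
    (fun _ => Finset.sum_le_sum fun _ _ => h _ _) hu

theorem MeasureTheory.LocallyIntegrable.absolutelyContinuousOnInterval_integral {E : Type*}
    [NormedAddCommGroup E] [NormedSpace ℝ E] {y : ℝ → E} (hy : LocallyIntegrable y volume)
    (x₀ : E) (c a b : ℝ) :
    AbsolutelyContinuousOnInterval (fun t => x₀ + ∫ v in c..t, y v) a b := by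
  have hi : ∀ a b, IntervalIntegrable y volume a b := fun a b =>
    intervalIntegrable_iff.2 ((hy.integrableOn_isCompact isCompact_uIcc).mono_set
      uIoc_subset_uIcc)
  -- The real-valued indefinite integral of the norm, on an interval that contains `c`.
  have hu : AbsolutelyContinuousOnInterval (fun t => ∫ v in c..t, ‖y v‖)
      (min a (min b c)) (max a (max b c)) := by
    refine (hi _ _).norm.absolutelyContinuousOnInterval_intervalIntegral ?_
    rw [mem_uIcc]
    left
    constructor <;> simp
  refine absolutelyContinuousOnInterval_of_dist_le (hu.mono ?_) fun s t => ?_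
  · rw [uIcc_subset_uIcc_iff_mem, mem_uIcc, mem_uIcc]
    constructor <;> left <;> constructor <;> simp
  · rw [dist_eq_norm, dist_eq_norm, add_sub_add_left_eq_sub,
      intervalIntegral.integral_interval_sub_left (hi _ _) (hi _ _),
      intervalIntegral.integral_interval_sub_left (hi _ _).norm (hi _ _).norm, Real.norm_eq_abs]
    exact intervalIntegral.norm_integral_le_abs_integral_norm

section Derivative

variable {p : ℝ} {μ : ℝ → ℝ}

theorem MemWeightedLp.memLp_volume (hp : 1 ≤ p) (hμ : IsWeight μ) {x : ℝ → ℂ}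
    (hx : MemWeightedLp p μ x) : MemLp x (ENNReal.ofReal p) volume :=
  hx.mono_measure (hμ.volume_le (by linarith))

theorem MemWeightedLp.locallyIntegrable (hp : 1 ≤ p) (hμ : IsWeight μ) {x : ℝ → ℂ}
    (hx : MemWeightedLp p μ x) : LocallyIntegrable x volume :=
  (hx.memLp_volume hp hμ).locallyIntegrable (one_le_ofReal_exponent hp)

/-- Convergence in the weighted space implies convergence of the integrals over bounded
intervals. -/
theorem tendsto_intervalIntegral_of_tendsto_weightedNorm (hp : 1 ≤ p) (hμ : IsWeight μ)
    {x : ℕ → ℝ → ℂ} {y : ℝ → ℂ} (hx : ∀ N, MemWeightedLp p μ (x N)) (hy : MemWeightedLp p μ y)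
    (h : Tendsto (fun N => weightedNorm p μ (x N - y)) atTop (𝓝 0)) (a b : ℝ) :
    Tendsto (fun N => ∫ t in a..b, x N t) atTop (𝓝 (∫ t in a..b, y t)) := by
  have hint : ∀ w : ℝ → ℂ, MemWeightedLp p μ w → Integrable w (volume.restrict (uIoc a b)) :=
    fun w hw => ((hw.locallyIntegrable hp hμ).integrableOn_isCompact isCompact_uIcc).mono_set
      uIoc_subset_uIcc
  simp only [intervalIntegral.intervalIntegral_eq_integral_uIoc]
  refine Tendsto.const_smul ?_ _
  refine tendsto_integral_of_L1' _ (hint y hy).1 (.of_forall fun N => hint _ (hx N)) ?_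
  have hV : volume.restrict (uIoc a b) univ ^
      (1 / (1 : ℝ≥0∞).toReal - 1 / (ENNReal.ofReal p).toReal) ≠ ∞ := by
    refine (ENNReal.rpow_lt_top_of_nonneg ?_ ?_).ne
    · rw [ENNReal.toReal_ofReal (by linarith), ENNReal.toReal_one, sub_nonneg]
      exact div_le_div_of_nonneg_left zero_le_one one_pos hp
    · simp [uIoc]
  have h0 := ENNReal.Tendsto.mul_const h (Or.inr hV)
  rw [zero_mul] at h0
  refine tendsto_of_tendsto_of_tendsto_of_le_of_le tendsto_const_nhds h0 (fun _ => zero_le)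
    fun N => ?_
  refine (eLpNorm_le_eLpNorm_mul_rpow_measure_univ (one_le_ofReal_exponent hp)
    (MemWeightedLp.memLp_volume hp hμ ((hx N).sub hy)).1.restrict).trans ?_
  gcongr
  exact eLpNorm_mono_measure _ (Measure.restrict_le_self.trans (hμ.volume_le (by linarith)))

/-- The differentiation operator is closed along sequences of entire functions. -/
theorem isDerivative_of_tendsto (hp : 1 ≤ p) (hμ : IsWeight μ) {F : ℕ → ℂ → ℂ}
    (hFd : ∀ N, Differentiable ℂ (F N)) (hF : ∀ N, MemWeightedLp p μ fun s : ℝ => F N s)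
    (hF' : ∀ N, MemWeightedLp p μ fun s : ℝ => deriv (F N) s) {x y : ℝ → ℂ}
    (hx : MemWeightedLp p μ x) (hy : MemWeightedLp p μ y)
    (hFx : Tendsto (fun N => weightedNorm p μ ((fun s : ℝ => F N s) - x)) atTop (𝓝 0))
    (hFy : Tendsto (fun N => weightedNorm p μ ((fun s : ℝ => deriv (F N) s) - y)) atTop (𝓝 0)) :
    IsDerivative p μ x y := by
  have hp0 : ENNReal.ofReal p ≠ 0 := (zero_lt_one.trans_le (one_le_ofReal_exponent hp)).ne'
  obtain ⟨ns, hns, hae⟩ := (tendstoInMeasure_of_tendsto_eLpNorm hp0 (fun N => (hF N).1) hx.1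
    hFx).exists_seq_tendsto_ae
  rw [hμ.ae_iff] at hae
  obtain ⟨s₀, hs₀⟩ := hae.exists
  have hyl := hy.locallyIntegrable hp hμ
  refine ⟨hx, hy, fun t => x s₀ + ∫ v in s₀..t, y v, ?_, fun a b =>
    hyl.absolutelyContinuousOnInterval_integral _ _ a b, ?_⟩
  · filter_upwards [hae] with t ht
    refine tendsto_nhds_unique ht ?_
    have hint := (tendsto_intervalIntegral_of_tendsto_weightedNorm hp hμ hF' hy hFy s₀ t).comp
      hns.tendsto_atTop
    refine (hs₀.add hint).congr fun N => ?_
    simp only [Function.comp_apply]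
    rw [intervalIntegral.integral_eq_sub_of_hasDerivAt (f := fun s : ℝ => F (ns N) s)
      (fun s _ => (hFd _ _).hasDerivAt.comp_ofReal)
      (((continuous_deriv_of_differentiable (hFd _)).comp
        Complex.continuous_ofReal).intervalIntegrable _ _)]
    ring
  · filter_upwards [_root_.LocallyIntegrable.ae_hasDerivAt_integral hyl] with t ht
    exact (ht s₀).const_add _

theorem continuous_of_forall_absolutelyContinuousOnInterval {z : ℝ → ℂ}
    (h : ∀ a b : ℝ, AbsolutelyContinuousOnInterval z a b) : Continuous z := by
  rw [continuous_iff_continuousAt]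
  intro t
  refine (h (t - 1) (t + 1)).continuousOn.continuousAt ?_
  rw [uIcc_of_le (by linarith)]
  exact Icc_mem_nhds (by linarith) (by linarith)

theorem IsDerivative.ae_unique {x x' y y' : ℝ → ℂ} (h : IsDerivative p μ x y)
    (h' : IsDerivative p μ x' y') (hx : x =ᵐ[volume] x') : y =ᵐ[volume] y' := by
  obtain ⟨-, -, z, hz, hac, hd⟩ := h
  obtain ⟨-, -, z', hz', hac', hd'⟩ := h'
  have hzz : z = z' := ((continuous_of_forall_absolutelyContinuousOnInterval hac).ae_eq_iff_eq
    volume (continuous_of_forall_absolutelyContinuousOnInterval hac')).1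
      ((hz.symm.trans hx).trans hz')
  subst hzz
  filter_upwards [hd, hd'] with t ht ht' using ht.unique ht'

theorem IsNthDerivative.ae_unique {n : ℕ} {f g g' : ℝ → ℂ} (h : IsNthDerivative p μ n f g)
    (h' : IsNthDerivative p μ n f g') : g =ᵐ[volume] g' := by
  induction n generalizing g g' with
  | zero => exact h.2.symm.trans h'.2
  | succ n ih =>
    obtain ⟨w, hw, hg⟩ := h
    obtain ⟨w', hw', hg'⟩ := h'
    exact hg.ae_unique hg' (ih hw hw')

theorem isNthDerivative_of_tendsto (hp : 1 ≤ p) (hμ : IsWeight μ) {F : ℕ → ℂ → ℂ} {n : ℕ}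
    (hFd : ∀ N i, Differentiable ℂ (deriv^[i] (F N)))
    (hF : ∀ N i, MemWeightedLp p μ fun s : ℝ => deriv^[i] (F N) s) {S : ℕ → ℝ → ℂ}
    (hS : ∀ i ≤ n, MemWeightedLp p μ (S i))
    (hFS : ∀ i ≤ n, Tendsto (fun N => weightedNorm p μ ((fun s : ℝ => deriv^[i] (F N) s) - S i))
      atTop (𝓝 0)) :
    IsNthDerivative p μ n (S 0) (S n) := by
  induction n with
  | zero => exact ⟨hS 0 le_rfl, .rfl⟩
  | succ n ih =>
    refine ⟨S n, ih (fun i hi => hS i (by omega)) (fun i hi => hFS i (by omega)), ?_⟩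
    refine isDerivative_of_tendsto hp hμ (F := fun N => deriv^[n] (F N)) (fun N => hFd N n)
      (fun N => hF N n) (fun N => ?_) (hS n (by omega)) (hS _ le_rfl) (hFS n (by omega)) ?_
    · simpa only [Function.iterate_succ_apply'] using hF N (n + 1)
    · simpa only [Function.iterate_succ_apply'] using hFS (n + 1) le_rfl

end Derivative

/-! ### Dyadic sums of the majorant -/

section Dyadic

variable {ω : ℝ → ℝ} {c : ℝ}

theorem half_pow_mem_Icc (j : ℕ) : ((1 / 2 : ℝ) ^ j) ∈ Icc (0 : ℝ) 1 :=
  ⟨by positivity, pow_le_one₀ (by norm_num) (by norm_num)⟩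

/-- The doubling condition at the dyadic points. -/
theorem dyadic_le_mul_succ (hdbl : ∀ t ∈ Icc (0 : ℝ) 1, ω (2 * t) ≤ c * ω t) (j : ℕ) :
    ω ((1 / 2) ^ j) ≤ c * ω ((1 / 2) ^ (j + 1)) := by
  have := hdbl _ (half_pow_mem_Icc (j + 1))
  rwa [show (2 : ℝ) * (1 / 2) ^ (j + 1) = (1 / 2) ^ j by ring] at this

theorem sum_integral_half_pow {G : ℝ → ℝ}
    (hG : ∀ j : ℕ, IntervalIntegrable G volume ((1 / 2) ^ j) ((1 / 2) ^ (j + 1))) (a n : ℕ) :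
    ∑ j ∈ Finset.range n, ∫ u in (1 / 2 : ℝ) ^ (a + j + 1)..(1 / 2) ^ (a + j), G u =
      ∫ u in (1 / 2 : ℝ) ^ (a + n)..(1 / 2) ^ a, G u := by
  have := intervalIntegral.sum_integral_adjacent_intervals (f := G) (μ := volume)
    (a := fun j : ℕ => (1 / 2 : ℝ) ^ (a + j)) (n := n) fun k _ => hG (a + k)
  rw [intervalIntegral.integral_symm ((1 / 2 : ℝ) ^ a)]
  rw [show (1 / 2 : ℝ) ^ a = (1 / 2) ^ (a + 0) by rw [add_zero], ← this, ← Finset.sum_neg_distrib]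
  refine Finset.sum_congr rfl fun j _ => ?_
  rw [intervalIntegral.integral_symm]
  rfl

theorem intervalIntegrable_div_pow (hcont : ContinuousOn ω (Ici 0)) (k : ℕ) {a b : ℝ} (ha : 0 < a)
    (hb : 0 < b) : IntervalIntegrable (fun u => ω u / u ^ k) volume a b := by
  have hpos : ∀ u ∈ uIcc a b, 0 < u := fun u hu => (lt_min ha hb).trans_le hu.1
  refine ContinuousOn.intervalIntegrable (ContinuousOn.div (hcont.mono fun u hu => (hpos u hu).le)
    (by fun_prop) fun u hu => (pow_pos (hpos u hu) k).ne')

/-- The contribution of one dyadic interval to the integral, bounded below by the value of `ω` at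
its left end. -/
theorem two_pow_mul_dyadic_succ_le (hcont : ContinuousOn ω (Ici 0)) (hmono : MonotoneOn ω (Ici 0))
    (hpos : ∀ t, 0 < t → 0 < ω t) (j k : ℕ) :
    2 ^ (j * k) * ω ((1 / 2) ^ (j + 1)) ≤
      2 * ∫ u in (1 / 2 : ℝ) ^ (j + 1)..(1 / 2) ^ j, ω u / u ^ (k + 1) := by
  set a : ℝ := (1 / 2) ^ (j + 1) with ha
  have ha0 : 0 < a := by positivity
  have e : (1 / 2 : ℝ) ^ j = 2 * a := by rw [ha]; ring
  have e2 : (2 : ℝ) ^ (j * k) = 1 / (2 * a) ^ k := by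
    rw [← e, pow_mul, one_div, one_div, inv_pow, inv_pow, inv_inv]
  rw [e, e2]
  have hlow : ∫ _ in a..(2 * a), ω a / (2 * a) ^ (k + 1) ≤
      ∫ u in a..(2 * a), ω u / u ^ (k + 1) := by
    refine intervalIntegral.integral_mono_on (by linarith) (by simp)
      (intervalIntegrable_div_pow hcont _ ha0 (by linarith)) fun u hu => ?_
    have hu0 : 0 < u := ha0.trans_le hu.1
    refine div_le_div₀ (hpos u hu0).le (hmono ha0.le hu0.le hu.1) (by positivity) ?_
    exact pow_le_pow_left₀ hu0.le hu.2 _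
  rw [intervalIntegral.integral_const, smul_eq_mul] at hlow
  refine le_trans (le_of_eq ?_) (mul_le_mul_of_nonneg_left hlow zero_le_two)
  rw [pow_succ]
  field_simp
  ring

/-- Low frequencies: the doubling condition moves the value of `ω` to the left end of the dyadic
interval, so that all intervals used lie in `[t, 1]`. -/
theorem sum_two_pow_mul_dyadic_le (hcont : ContinuousOn ω (Ici 0)) (hmono : MonotoneOn ω (Ici 0))
    (hpos : ∀ t, 0 < t → 0 < ω t) (hc : 0 < c)
    (hdbl : ∀ t ∈ Icc (0 : ℝ) 1, ω (2 * t) ≤ c * ω t) (k M : ℕ) {t : ℝ} (ht : 0 < t)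
    (htM : t ≤ (1 / 2) ^ (M + 1)) :
    ∑ j ∈ Finset.range (M + 1), 2 ^ (j * k) * ω ((1 / 2) ^ j) ≤
      2 * c * ∫ u in t..1, ω u / u ^ (k + 1) := by
  calc ∑ j ∈ Finset.range (M + 1), 2 ^ (j * k) * ω ((1 / 2) ^ j)
      ≤ ∑ j ∈ Finset.range (M + 1), c *
          (2 * ∫ u in (1 / 2 : ℝ) ^ (0 + j + 1)..(1 / 2) ^ (0 + j), ω u / u ^ (k + 1)) := by
        refine Finset.sum_le_sum fun j _ => ?_
        rw [zero_add]
        refine le_trans ?_ (mul_le_mul_of_nonneg_left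
          (two_pow_mul_dyadic_succ_le hcont hmono hpos j k) hc.le)
        rw [mul_left_comm]
        gcongr
        exact dyadic_le_mul_succ hdbl j
    _ = 2 * c * ∫ u in (1 / 2 : ℝ) ^ (M + 1)..1, ω u / u ^ (k + 1) := by
        rw [← Finset.mul_sum, ← Finset.mul_sum, sum_integral_half_pow
          (fun j => intervalIntegrable_div_pow hcont _ (by positivity) (by positivity)),
          zero_add, pow_zero]
        ring
    _ ≤ _ := by
        refine mul_le_mul_of_nonneg_left ?_ (by positivity)
        refine intervalIntegral.integral_mono_interval htM
          (half_pow_mem_Icc (M + 1)).2 le_rfl ?_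
          (intervalIntegrable_div_pow hcont _ ht one_pos)
        filter_upwards [ae_restrict_mem measurableSet_Ioc] with u hu
        have hu0 : 0 < u := ht.trans hu.1
        exact div_nonneg (hpos u hu0).le (by positivity)

/-- High frequencies: the doubling condition is used twice, because `t` may be as small as
`2 ^ (-M - 1)` while the sum starts with `ω (2 ^ (-M))`. -/
theorem sum_dyadic_tail_le (hcont : ContinuousOn ω (Ici 0)) (hmono : MonotoneOn ω (Ici 0))
    (hpos : ∀ t, 0 < t → 0 < ω t) (hc : 0 < c)
    (hdbl : ∀ t ∈ Icc (0 : ℝ) 1, ω (2 * t) ≤ c * ω t)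
    (hint : IntegrableOn (fun t : ℝ => ω t / t) (Ioc 0 1)) (M n : ℕ) {t : ℝ} (ht1 : t ≤ 1)
    (htM : (1 / 2) ^ (M + 1) ≤ t) :
    ∑ j ∈ Finset.range n, ω ((1 / 2) ^ (M + j)) ≤ 2 * c ^ 2 * ∫ u in (0 : ℝ)..t, ω u / u := by
  have ht0 : 0 < t := (by positivity : (0 : ℝ) < (1 / 2) ^ (M + 1)).trans_le htM
  calc ∑ j ∈ Finset.range n, ω ((1 / 2) ^ (M + j))
      ≤ ∑ j ∈ Finset.range n, 2 * c ^ 2 *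
          ∫ u in (1 / 2 : ℝ) ^ (M + 1 + j + 1)..(1 / 2) ^ (M + 1 + j), ω u / u ^ (0 + 1) := by
        refine Finset.sum_le_sum fun j _ => ?_
        have h1 := dyadic_le_mul_succ hdbl (M + j)
        have h2 := dyadic_le_mul_succ hdbl (M + j + 1)
        have h3 := two_pow_mul_dyadic_succ_le hcont hmono hpos (M + j + 1) 0
        rw [mul_zero, pow_zero, one_mul] at h3
        rw [show M + 1 + j = M + j + 1 by omega]
        calc ω ((1 / 2) ^ (M + j)) ≤ c * (c * ω ((1 / 2) ^ (M + j + 1 + 1))) :=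
              h1.trans (mul_le_mul_of_nonneg_left h2 hc.le)
          _ = c ^ 2 * ω ((1 / 2) ^ (M + j + 1 + 1)) := by ring
          _ ≤ _ := by
              rw [mul_comm 2, mul_assoc]
              exact mul_le_mul_of_nonneg_left h3 (by positivity)
    _ = 2 * c ^ 2 * ∫ u in (1 / 2 : ℝ) ^ (M + 1 + n)..(1 / 2) ^ (M + 1), ω u / u := by
        rw [← Finset.mul_sum, sum_integral_half_pow
          (fun j => intervalIntegrable_div_pow hcont _ (by positivity) (by positivity))]
        simp
    _ ≤ _ := by
        refine mul_le_mul_of_nonneg_left ?_ (by positivity)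
        refine intervalIntegral.integral_mono_interval (by positivity) ?_ htM ?_ ?_
        · exact pow_le_pow_of_le_one (by norm_num) (by norm_num) (by omega)
        · filter_upwards [ae_restrict_mem measurableSet_Ioc] with u hu
          exact div_nonneg (hpos u hu.1).le hu.1.le
        · rw [intervalIntegrable_iff_integrableOn_Ioc_of_le ht0.le]
          exact hint.mono_set (Ioc_subset_Ioc_right ht1)

theorem summable_dyadic (hcont : ContinuousOn ω (Ici 0)) (hmono : MonotoneOn ω (Ici 0))
    (hpos : ∀ t, 0 < t → 0 < ω t) (hc : 0 < c)
    (hdbl : ∀ t ∈ Icc (0 : ℝ) 1, ω (2 * t) ≤ c * ω t)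
    (hint : IntegrableOn (fun t : ℝ => ω t / t) (Ioc 0 1)) :
    Summable fun j : ℕ => ω ((1 / 2) ^ j) :=
  summable_of_sum_range_le (fun j => (hpos _ (by positivity)).le) fun n => by
    simpa using sum_dyadic_tail_le hcont hmono hpos hc hdbl hint 0 n le_rfl (by norm_num)

theorem tsum_dyadic_tail_le (hcont : ContinuousOn ω (Ici 0)) (hmono : MonotoneOn ω (Ici 0))
    (hpos : ∀ t, 0 < t → 0 < ω t) (hc : 0 < c)
    (hdbl : ∀ t ∈ Icc (0 : ℝ) 1, ω (2 * t) ≤ c * ω t)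
    (hint : IntegrableOn (fun t : ℝ => ω t / t) (Ioc 0 1)) (M : ℕ) {t : ℝ} (ht1 : t ≤ 1)
    (htM : (1 / 2) ^ (M + 1) ≤ t) :
    ∑' j : ℕ, ω ((1 / 2) ^ (M + j)) ≤ 2 * c ^ 2 * ∫ u in (0 : ℝ)..t, ω u / u :=
  Real.tsum_le_of_sum_range_le (fun j => (hpos _ (by positivity)).le) fun n =>
    sum_dyadic_tail_le hcont hmono hpos hc hdbl hint M n ht1 htM

end Dyadic

/-! ### The inverse approximation theorem -/

section Inverse

variable {p K : ℝ} {μ : ℝ → ℝ}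

theorem iterate_deriv_sub (i : ℕ) {F G : ℂ → ℂ} (hF : Differentiable ℂ F)
    (hG : Differentiable ℂ G) :
    deriv^[i] (fun z => F z - G z) = fun z => deriv^[i] F z - deriv^[i] G z := by
  induction i generalizing F G with
  | zero => rfl
  | succ i ih =>
    have h : deriv (fun z => F z - G z) = fun z => deriv F z - deriv G z :=
      funext fun z => deriv_fun_sub (hF z) (hG z)
    rw [Function.iterate_succ_apply, h,
      ih (fun z => (hF.analyticAt z).deriv.differentiableAt)
        (fun z => (hG.analyticAt z).deriv.differentiableAt)]
    rfl

/-- A sequence with summable increments converges in the weighted space, and the distance to the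
limit is at most the tail of the series of increments. -/
theorem exists_limit_of_summable_increments (hp : 1 ≤ p) {x : ℕ → ℝ → ℂ}
    (hx : ∀ N, MemWeightedLp p μ (x N)) {d : ℕ → ℝ} (hd0 : ∀ N, 0 ≤ d N) (hd : Summable d)
    (h : ∀ N, weightedNorm p μ (x (N + 1) - x N) ≤ ENNReal.ofReal (d N)) :
    ∃ S : ℝ → ℂ, MemWeightedLp p μ S ∧
      Tendsto (fun N => weightedNorm p μ (x N - S)) atTop (𝓝 0) ∧
      ∀ N, weightedNorm p μ (S - x N) ≤ ENNReal.ofReal (∑' m, d (N + m)) := by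
  have hfact : Fact (1 ≤ ENNReal.ofReal p) := ⟨one_le_ofReal_exponent hp⟩
  set a : ℕ → Lp ℂ (ENNReal.ofReal p) (weightMeasure p μ) := fun N => (hx N).toLp _ with ha
  have hdist : ∀ N, dist (a N) (a N.succ) ≤ d N := fun N => by
    rw [dist_comm, ← ENNReal.ofReal_le_ofReal_iff (hd0 N), ← edist_dist]
    exact (Lp.edist_toLp_toLp _ _ _ _).trans_le (h N)
  obtain ⟨s, hs⟩ := cauchySeq_tendsto_of_complete (cauchySeq_of_dist_le_of_summable d hdist hd)
  have hsm : MemWeightedLp p μ s := Lp.memLp s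
  have he : ∀ N, edist (a N) s = weightedNorm p μ (x N - s) := fun N => by
    conv_lhs => rw [← Lp.toLp_coeFn s hsm]
    exact Lp.edist_toLp_toLp _ _ _ _
  refine ⟨s, hsm, ?_, fun N => ?_⟩
  · simpa only [he] using tendsto_iff_edist_tendsto_0.1 hs
  · have := dist_le_tsum_of_dist_le_of_tendsto d hdist hd hs N
    rw [weightedNorm, eLpNorm_sub_comm, ← weightedNorm, ← he, edist_dist]
    exact ENNReal.ofReal_le_ofReal this

theorem exists_bandLimited_of_bestApprox_lt {r : ℝ} {f : ℝ → ℂ} {B : ℝ≥0∞}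
    (h : bestApprox p μ r f < B) :
    ∃ F, BandLimited p μ r F ∧ weightedNorm p μ (fun s => f s - F s) < B := by
  simp only [bestApprox, iInf_lt_iff] at h
  obtain ⟨F, hF, hlt⟩ := h
  exact ⟨F, hF, hlt⟩

/-- Near-best approximations of type `2 ^ j`. Bernstein's inequality compensates the factor
`2 ^ (-j * n)` in the rate of approximation, so the increments of the first `n` derivatives are
bounded by `ω (2 ^ (-j))`. -/
theorem exists_approximating_sequence (hp : 1 ≤ p) (hK : BernsteinBound p μ K) {ω : ℝ → ℝ} {c : ℝ}
    (hpos : ∀ t, 0 < t → 0 < ω t) (hc : 0 < c)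
    (hdbl : ∀ t ∈ Icc (0 : ℝ) 1, ω (2 * t) ≤ c * ω t)
    (hsum : Summable fun j : ℕ => ω ((1 / 2) ^ j)) {f : ℝ → ℂ} (hf : MemWeightedLp p μ f)
    {n : ℕ} {m : ℝ} (hm : 0 < m)
    (hE : ∀ r : ℝ, 1 ≤ r → bestApprox p μ r f ≤ ENNReal.ofReal (m / r ^ n * ω (1 / r))) :
    ∃ (g : ℕ → ℂ → ℂ) (L : ℝ), 0 ≤ L ∧ (∀ j, BandLimited p μ (2 ^ j) (g j)) ∧
      Tendsto (fun j => weightedNorm p μ ((fun s : ℝ => g j s) - f)) atTop (𝓝 0) ∧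
      ∀ j i, i ≤ n → weightedNorm p μ
        ((fun s : ℝ => deriv^[i] (g (j + 1)) s) - fun s : ℝ => deriv^[i] (g j) s) ≤
          ENNReal.ofReal (L * ω ((1 / 2) ^ (j + 1))) := by
  have hω : ∀ j : ℕ, 0 < ω ((1 / 2) ^ j) := fun j => hpos _ (by positivity)
  have hex : ∀ j : ℕ, ∃ F, BandLimited p μ (2 ^ j) F ∧ weightedNorm p μ (fun s => f s - F s) <
      ENNReal.ofReal (2 * m / (2 ^ j) ^ n * ω ((1 / 2) ^ j)) := fun j => by
    refine exists_bandLimited_of_bestApprox_lt ((hE (2 ^ j) (one_le_pow₀ one_le_two)).trans_lt ?_)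
    have hj := hω j
    rw [one_div_pow] at hj ⊢
    refine (ENNReal.ofReal_lt_ofReal_iff (by positivity)).2 ?_
    gcongr
    linarith
  choose g hg hgf using hex
  have hgf' : ∀ j, weightedNorm p μ ((fun s : ℝ => g j s) - f) ≤
      ENNReal.ofReal (2 * m / (2 ^ j) ^ n * ω ((1 / 2) ^ j)) := fun j => by
    rw [weightedNorm, eLpNorm_sub_comm]
    exact (hgf j).le
  set D : ℝ := 2 * m * (c * 2 ^ n + 1) with hD
  have hD0 : 0 ≤ D := by positivity
  set K' := max K 1 with hK'
  have hinc : ∀ j, weightedNorm p μ ((fun s : ℝ => g (j + 1) s) - fun s : ℝ => g j s) ≤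
      ENNReal.ofReal (D / (2 ^ (j + 1)) ^ n * ω ((1 / 2) ^ (j + 1))) := fun j => by
    have e : ((fun s : ℝ => g (j + 1) s) - fun s : ℝ => g j s) =
        ((fun s : ℝ => g (j + 1) s) - f) - ((fun s : ℝ => g j s) - f) := by abel
    rw [e]
    refine (eLpNorm_sub_le ((hg _).2.sub hf).1 ((hg _).2.sub hf).1
      (one_le_ofReal_exponent hp)).trans ((add_le_add (hgf' (j + 1)) (hgf' j)).trans ?_)
    have hj := hω j
    have hj1 := hω (j + 1)
    rw [← ENNReal.ofReal_add (by positivity) (by positivity)]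
    refine ENNReal.ofReal_le_ofReal ?_
    have h1 := dyadic_le_mul_succ hdbl j
    calc _ ≤ 2 * m / (2 ^ (j + 1)) ^ n * ω ((1 / 2) ^ (j + 1)) +
          2 * m / (2 ^ j) ^ n * (c * ω ((1 / 2) ^ (j + 1))) := by gcongr
      _ = _ := by
        rw [hD, pow_succ (2 : ℝ) j, mul_pow]
        field_simp
        ring
  refine ⟨g, K' ^ n * D, by positivity, hg, ?_, fun j i hi => ?_⟩
  · have h0 : Tendsto (fun j : ℕ => ENNReal.ofReal (2 * m * ω ((1 / 2) ^ j))) atTop (𝓝 0) := by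
      have := ENNReal.tendsto_ofReal (hsum.tendsto_atTop_zero.const_mul (2 * m))
      simpa using this
    refine tendsto_of_tendsto_of_tendsto_of_le_of_le tendsto_const_nhds h0 (fun _ => zero_le)
      fun j => (hgf' j).trans (ENNReal.ofReal_le_ofReal ?_)
    have hj := hω j
    gcongr
    exact div_le_self (by positivity) (one_le_pow₀ (one_le_pow₀ one_le_two))
  · have hr : (1 : ℝ) ≤ 2 ^ (j + 1) := one_le_pow₀ one_le_two
    have hB : BandLimited p μ (2 ^ (j + 1)) (fun z => g (j + 1) z - g j z) :=
      (hg (j + 1)).sub ((hg j).mono (pow_le_pow_right₀ one_le_two (Nat.le_succ j)))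
    have h1 := hK.iterate_deriv_le hr hB i
    rw [iterate_deriv_sub i (hg (j + 1)).1.1 (hg j).1.1] at h1
    refine h1.trans ((mul_le_mul_right (hinc j) _).trans ?_)
    have hj1 := hω (j + 1)
    have hKn := hK.nonneg
    rw [← ENNReal.ofReal_mul (by positivity)]
    refine ENNReal.ofReal_le_ofReal ?_
    have hK'1 : 1 ≤ K' := le_max_right _ _
    set r : ℝ := 2 ^ (j + 1) with hrdef
    have h2 : (K * r) ^ i ≤ (K' * r) ^ n :=
      (pow_le_pow_left₀ (by positivity) (by gcongr; exact le_max_left _ _) i).trans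
        (pow_le_pow_right₀ (one_le_mul_of_one_le_of_one_le hK'1 hr) hi)
    calc (K * r) ^ i * (D / r ^ n * ω ((1 / 2) ^ (j + 1)))
        ≤ (K' * r) ^ n * (D / r ^ n * ω ((1 / 2) ^ (j + 1))) := by gcongr
      _ = _ := by rw [mul_pow]; field_simp

/-- The differences of a telescoping sum of functions of type `2 ^ j`: Bernstein's inequality
for differences is applied to each increment. -/
theorem weightedNorm_fwdDiff_iterate_le_sum (hp : 1 ≤ p) (hμ : IsWeight μ)
    (hK : BernsteinBound p μ K) {G : ℕ → ℂ → ℂ} (hG : ∀ j, BandLimited p μ (2 ^ j) (G j))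
    {b : ℕ → ℝ} (hb : ∀ j, 0 ≤ b j)
    (h0 : weightedNorm p μ (fun s : ℝ => G 0 s) ≤ ENNReal.ofReal (b 0))
    (hs : ∀ j, weightedNorm p μ ((fun s : ℝ => G (j + 1) s) - fun s : ℝ => G j s) ≤
      ENNReal.ofReal (b (j + 1))) {τ : ℝ} (hτ0 : 0 ≤ τ) (hτ1 : τ ≤ 1) (k M : ℕ) :
    weightedNorm p μ ((fwdDiff τ)^[k] fun s : ℝ => G M s) ≤
      ENNReal.ofReal (K ^ k * τ ^ k * ∑ j ∈ Finset.range (M + 1), 2 ^ (j * k) * b j) := by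
  have hKn := hK.nonneg
  induction M with
  | zero =>
    have h1 := hK.fwdDiff_iterate_le hp hμ (by simp) hτ0 hτ1 k (hG 0)
    refine h1.trans ((mul_le_mul_right h0 _).trans (le_of_eq ?_))
    rw [← ENNReal.ofReal_mul (by positivity)]
    simp [mul_pow]
  | succ M ih =>
    have hB : BandLimited p μ (2 ^ (M + 1)) (fun z => G (M + 1) z - G M z) :=
      (hG (M + 1)).sub ((hG M).mono (pow_le_pow_right₀ one_le_two (Nat.le_succ M)))
    have h1 := hK.fwdDiff_iterate_le hp hμ (one_le_pow₀ one_le_two) hτ0 hτ1 k hB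
    have h2 := h1.trans (mul_le_mul_right (hs M) _)
    have e : (fun s : ℝ => G (M + 1) s) =
        (fun s : ℝ => G M s) + fun s : ℝ => G (M + 1) s - G M s := by
      funext s; simp
    have hbM := hb (M + 1)
    rw [e, fwdDiff_iter_add, Finset.sum_range_succ, mul_add, ENNReal.ofReal_add
      (mul_nonneg (by positivity) (Finset.sum_nonneg fun j _ => mul_nonneg (by positivity) (hb j)))
      (by positivity)]
    refine (eLpNorm_add_le ((hG M).2.fwdDiff_iterate hp hμ τ k).1
      (hB.2.fwdDiff_iterate hp hμ τ k).1 (one_le_ofReal_exponent hp)).trans ?_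
    refine add_le_add ih (h2.trans (le_of_eq ?_))
    rw [← ENNReal.ofReal_mul (by positivity)]
    congr 1
    rw [mul_pow, mul_pow, ← pow_mul]
    ring

end Inverse

theorem mainTheorem5
    (p : ℝ) (hp : 1 ≤ p)
    (μ : ℝ → ℝ) (hμ : IsWeight μ)
    (ω : ℝ → ℝ)
    (hω_cont : ContinuousOn ω (Ici 0))
    (hω_mono : MonotoneOn ω (Ici 0))
    (hω_zero : ω 0 = 0)
    (hω_pos : ∀ t : ℝ, 0 < t → 0 < ω t)
    (hω_doubling : ∃ c : ℝ, 0 < c ∧ ∀ t ∈ Icc (0 : ℝ) 1, ω (2 * t) ≤ c * ω t)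
    (hω_int : IntegrableOn (fun t : ℝ => ω t / t) (Ioc 0 1))
    (f : ℝ → ℂ) (hf : MemWeightedLp p μ f)
    (n : ℕ) (hn : 1 ≤ n) (m : ℝ) (hm : 0 < m)
    (hE : ∀ r : ℝ, 1 ≤ r →
      bestApprox p μ r f ≤ ENNReal.ofReal (m / r ^ n * ω (1 / r))) :
    MemWeightedSobolev p μ n f ∧
      ∀ g : ℝ → ℂ, IsNthDerivative p μ n f g →
        ∀ k : ℕ, 1 ≤ k → ∃ mk : ℝ, 0 < mk ∧ ∀ t : ℝ, 0 < t → t ≤ 1 / 2 →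
          modulus p μ k t g ≤ ENNReal.ofReal
            (mk * (t ^ k * (∫ u in t..1, ω u / u ^ (k + 1)) + ∫ u in (0 : ℝ)..t, ω u / u)) := by
  obtain ⟨c, hc, hdbl⟩ := hω_doubling
  obtain ⟨K, hK⟩ := exists_bernsteinBound hp hμ
  have hsum := summable_dyadic hω_cont hω_mono hω_pos hc hdbl hω_int
  have hω : ∀ j : ℕ, 0 < ω ((1 / 2) ^ j) := fun j => hω_pos _ (by positivity)
  obtain ⟨G, L, hL, hG, hGf, hinc⟩ :=
    exists_approximating_sequence hp hK hω_pos hc hdbl hsum hf hm hE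
  have hr : ∀ j : ℕ, (1 : ℝ) ≤ 2 ^ j := fun j => one_le_pow₀ one_le_two
  have hGi : ∀ j i, BandLimited p μ (2 ^ j) (deriv^[i] (G j)) := fun j i =>
    (hG j).iterate_deriv hK (hr j) i
  have hd0 : ∀ j : ℕ, 0 ≤ L * ω ((1 / 2) ^ (j + 1)) := fun j => mul_nonneg hL (hω _).le
  have hds : Summable fun j : ℕ => L * ω ((1 / 2) ^ (j + 1)) :=
    ((summable_nat_add_iff 1).2 hsum).mul_left L
  -- The limits of the derivatives; the limit of order `0` is `f` itself.
  have hlim : ∀ i, ∃ S : ℝ → ℂ, (i = 0 → S = f) ∧ (i ≤ n → MemWeightedLp p μ S ∧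
      Tendsto (fun N => weightedNorm p μ ((fun s : ℝ => deriv^[i] (G N) s) - S)) atTop (𝓝 0) ∧
      (i ≠ 0 → ∀ N, weightedNorm p μ (S - fun s : ℝ => deriv^[i] (G N) s) ≤
        ENNReal.ofReal (∑' j, L * ω ((1 / 2) ^ (N + j + 1))))) := by
    intro i
    by_cases hi0 : i = 0
    · subst hi0
      exact ⟨f, fun _ => rfl, fun _ => ⟨hf, hGf, fun h => absurd rfl h⟩⟩
    by_cases hin : i ≤ n
    · obtain ⟨S, h1, h2, h3⟩ := exists_limit_of_summable_increments hp
        (x := fun N => fun s : ℝ => deriv^[i] (G N) s) (fun N => (hGi N i).2) hd0 hds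
        fun N => hinc N i hin
      exact ⟨S, fun h => absurd h hi0, fun _ => ⟨h1, h2, fun _ => h3⟩⟩
    · exact ⟨f, fun _ => rfl, fun h => absurd h hin⟩
  choose S hS0 hS using hlim
  have hderiv : IsNthDerivative p μ n f (S n) := by
    have := isNthDerivative_of_tendsto hp hμ (n := n) (F := G) (S := S)
      (fun N i => (hGi N i).1.1) (fun N i => (hGi N i).2) (fun i hi => (hS i hi).1)
      (fun i hi => (hS i hi).2.1)
    rwa [hS0 0 rfl] at this
  refine ⟨⟨S n, hderiv⟩, fun g hg k _ => ?_⟩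
  obtain ⟨hSn, -, htail⟩ := hS n le_rfl
  replace htail := htail (by omega)
  set M₀ := max (μ 0) (μ 1) with hM₀
  have hM₀0 : 0 ≤ M₀ := (hμ.pos 0).le.trans (le_max_left _ _)
  have hKn := hK.nonneg
  set A := (weightedNorm p μ fun s : ℝ => deriv^[n] (G 0) s).toReal with hA
  have hA0 : 0 ≤ A := ENNReal.toReal_nonneg
  have hω1 := hω 0
  -- A constant that also absorbs the norm of the first approximation.
  set Q := L + A / ω ((1 / 2) ^ 0) with hQ
  have hQ0 : 0 ≤ Q := by positivity
  have hAQ : A ≤ Q * ω ((1 / 2) ^ 0) := by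
    rw [hQ, add_mul, div_mul_cancel₀ _ hω1.ne']
    have := mul_nonneg hL hω1.le
    linarith
  have hLQ : L ≤ Q := le_add_of_nonneg_right (by positivity)
  refine ⟨K ^ k * Q * (2 * c) + (M₀ + 1) ^ k * L * (2 * c ^ 2) + 1, by positivity,
    fun t ht0 ht1 => ?_⟩
  rw [modulus_congr hμ (hg.ae_unique hderiv)]
  refine iSup₂_le fun τ hτ => ?_
  have hτ1 : τ ≤ 1 := by linarith [hτ.2]
  -- The splitting index: `2 ^ (-M - 2) < t ≤ 2 ^ (-M - 1)`.
  obtain ⟨M, hM1, hM2⟩ := exists_nat_pow_near_of_lt_one (x := 2 * t) (y := 1 / 2) (by linarith)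
    (by linarith) (by norm_num) (by norm_num)
  have hM1' : (1 / 2 : ℝ) ^ (M + 1 + 1) ≤ t := by rw [pow_succ]; linarith
  have hM2' : t ≤ (1 / 2 : ℝ) ^ (M + 1) := by rw [pow_succ]; linarith
  set x : ℝ → ℂ := fun s => deriv^[n] (G M) s with hx
  have hxm : MemWeightedLp p μ x := (hGi M n).2
  set I₁ := ∫ u in t..1, ω u / u ^ (k + 1) with hI₁
  set I₂ := ∫ u in (0 : ℝ)..t, ω u / u with hI₂
  have hhead := sum_two_pow_mul_dyadic_le hω_cont hω_mono hω_pos hc hdbl k M ht0 hM2'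
  have hrest := tsum_dyadic_tail_le hω_cont hω_mono hω_pos hc hdbl hω_int (M + 1)
    (by linarith) hM1'
  have hI₁0 : 0 ≤ I₁ := intervalIntegral.integral_nonneg (by linarith) fun u hu =>
    div_nonneg (hω_pos u (ht0.trans_le hu.1)).le (pow_nonneg (ht0.le.trans hu.1) _)
  have hI₂0 : 0 ≤ I₂ := intervalIntegral.integral_nonneg ht0.le fun u hu => by
    rcases hu.1.eq_or_lt with rfl | h
    · simp
    · exact div_nonneg (hω_pos u h).le h.le
  have h1 : weightedNorm p μ ((fwdDiff τ)^[k] (S n - x)) ≤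
      ENNReal.ofReal ((M₀ + 1) ^ k * L * (2 * c ^ 2) * I₂) := by
    refine (weightedNorm_fwdDiff_iterate_le hp hμ (hSn.sub hxm) τ k).trans
      ((mul_le_mul_right (htail M) _).trans ?_)
    rw [← ENNReal.ofReal_mul (pow_nonneg (by linarith [hμ.pos τ]) _), tsum_mul_left]
    refine ENNReal.ofReal_le_ofReal ?_
    have hμτ : μ τ ≤ M₀ := hμ.le_max ((abs_of_nonneg hτ.1).le.trans hτ1)
    have hμτ0 := hμ.pos τ
    have e : ∀ j : ℕ, ω ((1 / 2) ^ (M + j + 1)) = ω ((1 / 2) ^ (M + 1 + j)) := fun j => by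
      rw [add_right_comm]
    simp only [e]
    calc (μ τ + 1) ^ k * (L * ∑' j : ℕ, ω ((1 / 2) ^ (M + 1 + j)))
        ≤ (M₀ + 1) ^ k * (L * (2 * c ^ 2 * I₂)) := by
          have : 0 ≤ ∑' j : ℕ, ω ((1 / 2) ^ (M + 1 + j)) := tsum_nonneg fun j => (hω _).le
          gcongr
      _ = _ := by ring
  have h2 : weightedNorm p μ ((fwdDiff τ)^[k] x) ≤
      ENNReal.ofReal (K ^ k * Q * (2 * c) * (t ^ k * I₁)) := by
    refine (weightedNorm_fwdDiff_iterate_le_sum hp hμ hK (G := fun j => deriv^[n] (G j))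
      (b := fun j => Q * ω ((1 / 2) ^ j)) (fun j => hGi j n) (fun j => mul_nonneg hQ0 (hω j).le)
      ?_ (fun j => ?_) hτ.1 hτ1 k M).trans (ENNReal.ofReal_le_ofReal ?_)
    · have hne : weightedNorm p μ (fun s : ℝ => deriv^[n] (G 0) s) ≠ ∞ := (hGi 0 n).2.2.ne
      rw [← ENNReal.ofReal_toReal hne]
      exact ENNReal.ofReal_le_ofReal hAQ
    · refine (hinc j n le_rfl).trans (ENNReal.ofReal_le_ofReal ?_)
      exact mul_le_mul_of_nonneg_right hLQ (hω _).le
    · have e : ∀ j ∈ Finset.range (M + 1), (2 : ℝ) ^ (j * k) * (Q * ω ((1 / 2) ^ j)) =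
          Q * (2 ^ (j * k) * ω ((1 / 2) ^ j)) := fun j _ => by ring
      rw [Finset.sum_congr rfl e, ← Finset.mul_sum]
      calc _ ≤ K ^ k * t ^ k * (Q * (2 * c * I₁)) := by
            have := hτ.1
            have := hτ.2
            have : 0 ≤ ∑ j ∈ Finset.range (M + 1), (2 : ℝ) ^ (j * k) * ω ((1 / 2) ^ j) :=
              Finset.sum_nonneg fun j _ => mul_nonneg (by positivity) (hω j).le
            gcongr
        _ = _ := by ring
  have e : S n = (S n - x) + x := by abel
  rw [e, fwdDiff_iter_add]
  refine (eLpNorm_add_le (MemWeightedLp.fwdDiff_iterate hp hμ (hSn.sub hxm) τ k).1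
    (hxm.fwdDiff_iterate hp hμ τ k).1 (one_le_ofReal_exponent hp)).trans
    ((add_le_add h1 h2).trans ?_)
  rw [← ENNReal.ofReal_add (by positivity) (by positivity)]
  refine ENNReal.ofReal_le_ofReal ?_
  set a := K ^ k * Q * (2 * c) with ha
  set b := (M₀ + 1) ^ k * L * (2 * c ^ 2) with hb
  have ha0 : 0 ≤ a := by positivity
  have hb0 : 0 ≤ b := by positivity
  have hJ : 0 ≤ t ^ k * I₁ := by positivity
  nlinarith [mul_nonneg hb0 hJ, mul_nonneg ha0 hI₂0]
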